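/- Let $X$ be a random variable with values in $\mathbb{R}^d$ with $\mathbb{E}\|X\|^2<\infty$, and let $Y$ be a random variable (the guidance signal) with values in a measurable space $\mathcal Y$, with law $P_Y$. Assume that for $P_Y$-almost every $y$ the conditional law of $X$ given $Y=y$ has a density $q(\cdot\mid y)$, so that $X$ has a density $q$ as well. Consider the linear conditional flow $\psi_t(x\mid x_1)=t x_1+(1-t)x$ with standard Gaussian prior $X_0\sim\mathcal N(0,I)$, its conditional path $p_{t\mid 1}(\cdot\mid x_1)=\mathcal N(\cdot\mid t x_1,(1-t)^2 I)$ and its conditional velocity field $u_t(x\mid x_1)=\frac{x_1-x}{1-t}$, $0\le t<1$. Define the guided and the unconditional marginal probability paths $$p_{t\mid Y}(x\mid y)=\int p_{t\mid 1}(x\mid x_1)\,q(x_1\mid y)\,dx_1,\qquad p_t(x)=\int p_{t\mid 1}(x\mid x_1)\,q(x_1)\,dx_1,$$ with $p_{1\mid Y}=q(\cdot\mid y)$ and $p_1=q$, and the guided and the unconditional marginal velocity fields $$u_t(x\mid y)=\int u_t(x\mid x_1)\frac{p_{t\mid 1}(x\mid x_1)q(x_1\mid y)}{p_{t\mid Y}(x\mid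 y)}\,dx_1,\qquad u_t(x)=\int u_t(x\mid x_1)\frac{p_{t\mid 1}(x\mid x_1)q(x_1)}{p_t(x)}\,dx_1 .$$ For $0<t<1$ put $$g(y,t)=\mathbb{E}_{X_t\sim p_{t\mid Y}(\cdot\mid y)}\Big[\tfrac{t}{1-t}\,u_t(X_t\mid y)\cdot\big(u_t(X_t\mid y)-u_t(X_t)\big)\Big],$$ and assume that $g$ is integrable on $\mathcal Y\times(0,1)$ with respect to $P_Y\otimes dt$. Then the mutual information $I(X;Y)=D_{\mathrm{KL}}(P_{(X,Y)}\,\|\,P_X\otimes P_Y)$ is finite, and $$I(X;Y)=\mathbb{E}_Y\big[D_{\mathrm{KL}}(P_{X\mid Y}\,\|\,P_X)\big]=\mathbb{E}_Y\Big[\int p_{1\mid Y}(x_1\mid Y)\log\frac{p_{1\mid Y}(x_1\mid Y)}{p_1(x_1)}\,dx_1\Big]$$ $$=\mathbb{E}_Y\Big[\int_0^1\mathbb{E}_{X_t\mid Y}\Big[\tfrac{t}{1-t}\,u_t(X_t\mid Y)\cdot\big(u_t(X_t\mid Y)-u_t(X_t)\big)\Big]dt\Big].$$ -/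

import Mathlib

open MeasureTheory ProbabilityTheory InformationTheory
open scoped ENNReal

namespace FlowMI

noncomputable section

/-- Mutual information `I(X;Y)`: the Kullback–Leibler divergence of the joint law from the product
of the marginal laws. -/
def mutualInfo {Ω S T : Type*} [MeasurableSpace Ω] [MeasurableSpace S] [MeasurableSpace T]
    (P : Measure Ω) (X : Ω → S) (Y : Ω → T) : ℝ≥0∞ :=
  klDiv (P.map fun ω => (X ω, Y ω)) ((P.map X).prod (P.map Y))

variable {d : ℕ}

/-- Lebesgue density of a measure on `ℝᵈ`. -/
def density (ν : Measure (EuclideanSpace ℝ (Fin d))) (x : EuclideanSpace ℝ (Fin d)) : ℝ :=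
  (ν.rnDeriv volume x).toReal

/-- The linear conditional flow `ψ_t(x ∣ x₁) = t x₁ + (1 - t) x`. -/
def linearFlow (t : ℝ) (x₁ x : EuclideanSpace ℝ (Fin d)) : EuclideanSpace ℝ (Fin d) :=
  t • x₁ + (1 - t) • x

/-- The probability path with target law `ν`: the law of `X_t = ψ_t(X₀ ∣ X₁)`, with `X₁ ∼ ν` and
`X₀ ∼ N(0, I)` independent. -/
def probPath (ν : Measure (EuclideanSpace ℝ (Fin d))) (t : ℝ) :
    Measure (EuclideanSpace ℝ (Fin d)) :=
  (ν.prod (stdGaussian (EuclideanSpace ℝ (Fin d)))).map fun z => linearFlow t z.1 z.2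

/-- The density `p_{t∣1}(x ∣ x₁)` of `N(t x₁, (1 - t)² I)`, the law of `ψ_t(X₀ ∣ x₁)`, for
`t < 1`. -/
def condPathDensity (t : ℝ) (x₁ x : EuclideanSpace ℝ (Fin d)) : ℝ :=
  ((√(2 * Real.pi) * (1 - t)) ^ d)⁻¹ * Real.exp (-‖x - t • x₁‖ ^ 2 / (2 * (1 - t) ^ 2))

/-- The velocity field `u_t(x ∣ x₁)` of the linear conditional flow, for `t < 1`. -/
def condVelocity (t : ℝ) (x₁ x : EuclideanSpace ℝ (Fin d)) : EuclideanSpace ℝ (Fin d) :=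
  (1 - t)⁻¹ • (x₁ - x)

/-- `d/dt ψ_t(x ∣ x₁) = u_t(ψ_t(x ∣ x₁) ∣ x₁)`. -/
theorem hasDerivAt_linearFlow (t : ℝ) (ht : t < 1) (x₁ x : EuclideanSpace ℝ (Fin d)) :
    HasDerivAt (fun s => linearFlow s x₁ x) (condVelocity t x₁ (linearFlow t x₁ x)) t := by
  have h : condVelocity t x₁ (linearFlow t x₁ x) = (1 : ℝ) • x₁ + (-1 : ℝ) • x := by
    have h1 : x₁ - linearFlow t x₁ x = (1 - t) • (x₁ - x) := by
      unfold linearFlow; module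
    rw [condVelocity, h1, smul_smul, inv_mul_cancel₀ (by linarith)]
    module
  rw [h]
  exact ((hasDerivAt_id t).smul_const x₁).add (((hasDerivAt_id t).const_sub 1).smul_const x)

/-- The marginal density `p_t(x) = ∫ p_{t∣1}(x ∣ x₁) ν(dx₁)`. -/
def pathDensity (ν : Measure (EuclideanSpace ℝ (Fin d))) (t : ℝ)
    (x : EuclideanSpace ℝ (Fin d)) : ℝ :=
  ∫ x₁, condPathDensity t x₁ x ∂ν

/-- The marginal velocity field `u_t(x) = ∫ u_t(x ∣ x₁) p_{1∣t}(x₁ ∣ x) dx₁`, where the posterior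
law `p_{1∣t}(· ∣ x)` has density `p_{t∣1}(x ∣ ·) / p_t(x)` with respect to the target law `ν`. -/
def velocity (ν : Measure (EuclideanSpace ℝ (Fin d))) (t : ℝ)
    (x : EuclideanSpace ℝ (Fin d)) : EuclideanSpace ℝ (Fin d) :=
  ∫ x₁, (condPathDensity t x₁ x / pathDensity ν t x) • condVelocity t x₁ x ∂ν

/-- `E_{X_t ∼ p_t^A} [t / (1 - t) * u_t^A(X_t) · (u_t^A(X_t) - u_t^B(X_t))]` for the probability
paths with target laws `A` and `B`. -/
def velocityGap (A B : Measure (EuclideanSpace ℝ (Fin d))) (t : ℝ) : ℝ :=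
  ∫ x, t / (1 - t) * inner ℝ (velocity A t x) (velocity A t x - velocity B t x) ∂(probPath A t)

end

end FlowMI

/-! For the linear path, X_t = (1 - t)(a X₁ + N) with signal strength a = t / (1 - t) and N standard
Gaussian. The velocity at (1 - t)z is therefore an affine function of the posterior mean of X₁ given
a X₁ + N = z, and two velocity fields differ by (1 - t)⁻¹ times the difference of the posterior
means (`velocity_sub_velocity`).

Fix target laws A and B with finite second moments. The divergence between the laws of a X + N under
X ∼ A and X ∼ B vanishes at a = 0 and has derivative a E‖m_A - m_B‖², the mismatched form of the
I-MMSE relation (`hasDerivAt_smoothedKL`, from Stein's identity and the tower property). It never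
exceeds KL(A‖B), by data processing, and its supremum over a is KL(A‖B), by the variational formula
with bounded continuous test functions. Since da/dt = (1 - t)⁻², this yields KL(A‖B) = ∫₀¹ t/(1-t)
E‖u^A - u^B‖² dt in [0, ∞] (`klDiv_eq_lintegral_velocitySqGap`).

The integrand in the theorem is u^A · (u^A - u^B), which differs from the square by u^B · (u^A -
u^B). By the tower property this cross term has the same mean as a function of signal and noise
involving B only. With A the conditional law given y and B the marginal law, averaging over y turns
A into B, and the mean is then zero because x - m_B is orthogonal to functions of the observation
(`integral_integral_crossTerm`). Finally, mutual information is the average of the conditional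
divergences (`klDiv_compProd_prod`). -/

namespace FlowMI

noncomputable section

set_option linter.unusedSectionVars false

/-! ### Gaussian integrals: Cameron–Martin and Stein -/

section Gaussian

variable {E : Type*} [NormedAddCommGroup E] [InnerProductSpace ℝ E] [FiniteDimensional ℝ E]
  [MeasurableSpace E] [BorelSpace E]

/-- Functions of at most exponential growth are integrable for the standard Gaussian. -/
theorem integrable_stdGaussian_of_norm_le_exp {F : Type*} [NormedAddCommGroup F] {f : E → F}
    (hf : AEStronglyMeasurable f (stdGaussian E)) {K c : ℝ}
    (h : ∀ z, ‖f z‖ ≤ K * Real.exp (c * ‖z‖)) : Integrable f (stdGaussian E) := by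
  obtain ⟨C, hC, hint⟩ := IsGaussian.exists_integrable_exp_sq (stdGaussian E)
  have hK : 0 ≤ K := by
    have := (norm_nonneg _).trans (h 0)
    simpa using this
  refine (hint.const_mul (K * Real.exp (c ^ 2 / (4 * C)))).mono' hf (ae_of_all _ fun z => ?_)
  refine (h z).trans ?_
  rw [mul_assoc, ← Real.exp_add]
  gcongr
  have h1 : 0 ≤ C * (‖z‖ - c / (2 * C)) ^ 2 := by positivity
  have h2 : C * (‖z‖ - c / (2 * C)) ^ 2 = C * ‖z‖ ^ 2 - c * ‖z‖ + c ^ 2 / (4 * C) := by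
    field_simp; ring
  linarith

/-- Functions of at most quadratic growth are integrable for the standard Gaussian. -/
theorem integrable_stdGaussian_of_norm_le_sq {F : Type*} [NormedAddCommGroup F] {f : E → F}
    (hf : AEStronglyMeasurable f (stdGaussian E)) {C : ℝ}
    (h : ∀ z, ‖f z‖ ≤ C * (1 + ‖z‖ ^ 2)) : Integrable f (stdGaussian E) := by
  have h2 : Integrable (fun z : E => ‖z‖ ^ 2) (stdGaussian E) :=
    IsGaussian.memLp_two_id.integrable_norm_pow (by norm_num)
  exact (((integrable_const 1).add h2).const_mul C).mono' hf (ae_of_all _ h)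

/-- In an orthonormal basis the integral factors into one-dimensional complex moment generating
functions exp(w²/2). The cases of zero tilt and of tilt `h` are the two characteristic functions
compared in the Cameron–Martin formula. -/
theorem integral_cexp_inner_stdGaussian (h t : E) :
    ∫ z, Complex.exp ((inner ℝ h z : ℝ) + (inner ℝ z t : ℝ) * Complex.I) ∂(stdGaussian E) =
      Complex.exp ((‖h‖ ^ 2 - ‖t‖ ^ 2 : ℝ) / 2 + (inner ℝ h t : ℝ) * Complex.I) := by
  rw [stdGaussian, integral_map (Measurable.aemeasurable (by fun_prop))
    (Continuous.aestronglyMeasurable (by fun_prop))]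
  set b := stdOrthonormalBasis ℝ E
  have h1 : ∀ x : Fin (Module.finrank ℝ E) → ℝ,
      Complex.exp ((inner ℝ h (∑ i, x i • b i) : ℝ) + (inner ℝ (∑ i, x i • b i) t : ℝ) * Complex.I)
      = ∏ i, Complex.exp ((inner ℝ (b i) h + inner ℝ (b i) t * Complex.I) * (x i : ℂ)) := by
    intro x
    rw [← Complex.exp_sum, inner_sum, sum_inner]
    congr 1
    push_cast
    rw [Finset.sum_mul, ← Finset.sum_add_distrib]
    refine Finset.sum_congr rfl fun i _ => ?_
    rw [real_inner_smul_left, real_inner_smul_right, real_inner_comm]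
    push_cast; ring
  simp_rw [h1]
  rw [integral_fintype_prod_eq_prod (f := fun i (x : ℝ) =>
    Complex.exp ((inner ℝ (b i) h + inner ℝ (b i) t * Complex.I) * (x : ℂ)))]
  have h2 : ∀ w : ℂ, ∫ x : ℝ, Complex.exp (w * x) ∂(gaussianReal 0 1) = Complex.exp (w ^ 2 / 2) := by
    intro w
    have := complexMGF_id_gaussianReal (μ := 0) (v := 1) w
    simpa [complexMGF] using this
  simp_rw [h2, ← Complex.exp_sum]
  congr 1
  rw [← b.sum_sq_inner_right h, ← b.sum_sq_inner_right t, ← b.sum_inner_mul_inner h t]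
  push_cast
  rw [← Finset.sum_sub_distrib, Finset.sum_div, Finset.sum_mul, ← Finset.sum_add_distrib]
  refine Finset.sum_congr rfl fun i _ => ?_
  rw [real_inner_comm h (b i)]
  linear_combination (((inner ℝ (b i) t : ℝ) : ℂ) ^ 2 / 2) * Complex.I_sq

theorem integrable_exp_inner_stdGaussian (h : E) (c : ℝ) :
    Integrable (fun z => Real.exp (inner ℝ h z - c)) (stdGaussian E) := by
  refine integrable_stdGaussian_of_norm_le_exp (Continuous.aestronglyMeasurable (by fun_prop))
    (K := Real.exp (-c)) (c := ‖h‖) fun z => ?_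
  rw [Real.norm_eq_abs, Real.abs_exp, ← Real.exp_add]
  gcongr
  linarith [real_inner_le_norm h z]

/-- **Cameron–Martin formula** for the standard Gaussian measure. -/
theorem map_add_left_stdGaussian (h : E) :
    (stdGaussian E).map (fun z => h + z) =
      (stdGaussian E).withDensity
        (fun z => ENNReal.ofReal (Real.exp (inner ℝ h z - ‖h‖ ^ 2 / 2))) := by
  have hfin : IsFiniteMeasure ((stdGaussian E).withDensity
      (fun z => ENNReal.ofReal (Real.exp (inner ℝ h z - ‖h‖ ^ 2 / 2)))) :=
    isFiniteMeasure_withDensity_ofReal (integrable_exp_inner_stdGaussian h _).2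
  have : IsFiniteMeasure ((stdGaussian E).map (fun z => h + z)) := by infer_instance
  refine Measure.ext_of_charFun (funext fun t => ?_)
  rw [charFun_apply, charFun_apply, integral_map (by fun_prop)
    (Continuous.aestronglyMeasurable (by fun_prop)),
    integral_withDensity_eq_integral_toReal_smul (by fun_prop) (by simp)]
  have h1 : ∀ z : E, Complex.exp ((inner ℝ (h + z) t : ℝ) * Complex.I) =
      Complex.exp ((inner ℝ h t : ℝ) * Complex.I) *
        Complex.exp ((inner ℝ (0 : E) z : ℝ) + (inner ℝ z t : ℝ) * Complex.I) := by
    intro z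
    rw [← Complex.exp_add, inner_add_left]
    push_cast
    simp; ring_nf
  have h2 : ∀ z : E, (ENNReal.ofReal (Real.exp (inner ℝ h z - ‖h‖ ^ 2 / 2))).toReal •
      Complex.exp ((inner ℝ z t : ℝ) * Complex.I) =
      Complex.exp (-(‖h‖ ^ 2 / 2 : ℝ)) *
        Complex.exp ((inner ℝ h z : ℝ) + (inner ℝ z t : ℝ) * Complex.I) := by
    intro z
    rw [ENNReal.toReal_ofReal (by positivity), Complex.real_smul, Complex.ofReal_exp,
      ← Complex.exp_add, ← Complex.exp_add]
    congr 1
    push_cast; ring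
  simp_rw [h1, h2, integral_const_mul, integral_cexp_inner_stdGaussian, ← Complex.exp_add]
  congr 1
  push_cast
  simp; ring

theorem lintegral_add_left_stdGaussian (h : E) {f : E → ℝ≥0∞} (hf : Measurable f) :
    ∫⁻ z, f (h + z) ∂(stdGaussian E) =
      ∫⁻ z, ENNReal.ofReal (Real.exp (inner ℝ h z - ‖h‖ ^ 2 / 2)) * f z ∂(stdGaussian E) := by
  rw [← lintegral_map (g := fun z => h + z) hf (by fun_prop), map_add_left_stdGaussian,
    lintegral_withDensity_eq_lintegral_mul _ (by fun_prop) hf]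
  rfl

theorem integral_add_left_stdGaussian (h : E) (f : E → ℝ) :
    ∫ z, f (h + z) ∂(stdGaussian E) =
      ∫ z, Real.exp (inner ℝ h z - ‖h‖ ^ 2 / 2) * f z ∂(stdGaussian E) := by
  have he : MeasurableEmbedding (fun z : E => h + z) := measurableEmbedding_addLeft h
  rw [← he.integral_map, map_add_left_stdGaussian,
    integral_withDensity_eq_integral_toReal_smul (by fun_prop) (by simp)]
  refine integral_congr_ae (ae_of_all _ fun z => ?_)
  simp [ENNReal.toReal_ofReal (Real.exp_pos _).le]

/-- **Stein's identity** (Gaussian integration by parts) in the direction `e`. -/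
theorem integral_inner_mul_stdGaussian (e : E) {φ φ' : E → ℝ} {C : ℝ} (hφ : Measurable φ)
    (hφ' : Measurable φ')
    (hd : ∀ z, HasDerivAt (fun s : ℝ => φ (z + s • e)) (φ' z) 0)
    (hb : ∀ z, |φ z| ≤ C * (1 + ‖z‖ ^ 2)) (hb' : ∀ z, |φ' z| ≤ C * (1 + ‖z‖ ^ 2)) :
    ∫ z, inner ℝ e z * φ z ∂(stdGaussian E) = ∫ z, φ' z ∂(stdGaussian E) := by
  have hC : 0 ≤ C := by simpa using (abs_nonneg _).trans (hb 0)
  have hball : Metric.ball (0 : ℝ) 1 ∈ nhds (0 : ℝ) := Metric.ball_mem_nhds _ one_pos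
  have hd' : ∀ z s, HasDerivAt (fun s : ℝ => φ (s • e + z)) (φ' (s • e + z)) s := by
    intro z s
    have h1 := hd (s • e + z)
    have h2 : HasDerivAt (fun r : ℝ => r - s) 1 s := (hasDerivAt_id s).sub_const s
    have h3 := HasDerivAt.comp (h₂ := fun s' : ℝ => φ ((s • e + z) + s' • e)) s
      (by simpa using h1) h2
    simp only [mul_one] at h3
    refine h3.congr_of_eventuallyEq (Filter.Eventually.of_forall fun r => ?_)
    simp only [Function.comp]
    congr 1
    module
  -- differentiate both sides of the Cameron–Martin formula at zero
  have hL := hasDerivAt_integral_of_dominated_loc_of_deriv_le (μ := stdGaussian E)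
    (F := fun (s : ℝ) z => φ (s • e + z)) (F' := fun s z => φ' (s • e + z)) (x₀ := 0)
    (s := Metric.ball 0 1) (bound := fun z => (C * (2 + 2 * ‖e‖ ^ 2)) * (1 + ‖z‖ ^ 2)) hball
    (Filter.Eventually.of_forall fun s => Measurable.aestronglyMeasurable (by fun_prop))
    (by simpa using integrable_stdGaussian_of_norm_le_sq hφ.aestronglyMeasurable hb)
    (Measurable.aestronglyMeasurable (by fun_prop))
    (ae_of_all _ fun z s hs => by
      refine (hb' _).trans ?_
      rw [mul_assoc]
      gcongr
      have hs1 : |s| ≤ 1 := by simpa using (Metric.mem_ball.1 hs).le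
      have h1 : ‖s • e + z‖ ≤ ‖e‖ + ‖z‖ := by
        refine (norm_add_le _ _).trans ?_
        rw [norm_smul, Real.norm_eq_abs]
        nlinarith [norm_nonneg e]
      have h2 : ‖s • e + z‖ ^ 2 ≤ (‖e‖ + ‖z‖) ^ 2 := by gcongr
      nlinarith [sq_nonneg (‖e‖ - ‖z‖), sq_nonneg ‖z‖, sq_nonneg (‖e‖ * ‖z‖)])
    (integrable_stdGaussian_of_norm_le_sq (C := C * (2 + 2 * ‖e‖ ^ 2))
      (Continuous.aestronglyMeasurable (by fun_prop))
      fun z => by rw [Real.norm_of_nonneg (by positivity)])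
    (ae_of_all _ fun z s _ => hd' z s)
  have hexp : ∀ (z : E) (s : ℝ), HasDerivAt
      (fun s : ℝ => Real.exp (s * inner ℝ e z - s ^ 2 * ‖e‖ ^ 2 / 2) * φ z)
      (Real.exp (s * inner ℝ e z - s ^ 2 * ‖e‖ ^ 2 / 2) * (inner ℝ e z - s * ‖e‖ ^ 2) * φ z) s := by
    intro z s
    refine HasDerivAt.mul_const (HasDerivAt.exp ?_) _
    have h1 := ((hasDerivAt_id s).mul_const (inner ℝ e z)).sub
      ((((hasDerivAt_id s).pow 2).mul_const (‖e‖ ^ 2)).div_const 2)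
    refine h1.congr_deriv ?_
    simp; ring
  -- Each polynomial factor is absorbed by one exponential exp(r), which leaves a dominating
  -- function of exponential growth.
  have hpoly : ∀ r : ℝ, 0 ≤ r → (1 + r ^ 2) * (‖e‖ * r + ‖e‖ ^ 2) ≤
      2 * (‖e‖ + ‖e‖ ^ 2) * Real.exp (2 * r) := by
    intro r hr
    have h1 := Real.quadratic_le_exp_of_nonneg hr
    have h2 : 1 + r ^ 2 ≤ 2 * Real.exp r := by nlinarith
    have h3 : ‖e‖ * r + ‖e‖ ^ 2 ≤ (‖e‖ + ‖e‖ ^ 2) * Real.exp r := by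
      have := norm_nonneg e
      have h5 : 1 + r ≤ Real.exp r := by linarith [Real.add_one_le_exp r]
      nlinarith [sq_nonneg ‖e‖, mul_nonneg this hr]
    calc _ ≤ 2 * Real.exp r * ((‖e‖ + ‖e‖ ^ 2) * Real.exp r) := by gcongr
      _ = _ := by rw [two_mul r, Real.exp_add]; ring
  have hR := hasDerivAt_integral_of_dominated_loc_of_deriv_le (μ := stdGaussian E)
    (F := fun (s : ℝ) z => Real.exp (s * inner ℝ e z - s ^ 2 * ‖e‖ ^ 2 / 2) * φ z)
    (F' := fun s z =>
      Real.exp (s * inner ℝ e z - s ^ 2 * ‖e‖ ^ 2 / 2) * (inner ℝ e z - s * ‖e‖ ^ 2) * φ z)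
    (x₀ := 0) (s := Metric.ball 0 1)
    (bound := fun z => C * (2 * (‖e‖ + ‖e‖ ^ 2)) * Real.exp ((2 + ‖e‖) * ‖z‖)) hball
    (Filter.Eventually.of_forall fun s => Measurable.aestronglyMeasurable (by fun_prop))
    (by simpa using integrable_stdGaussian_of_norm_le_sq hφ.aestronglyMeasurable hb)
    (Measurable.aestronglyMeasurable (by fun_prop))
    (ae_of_all _ fun z s hs => by
      have hs1 : |s| ≤ 1 := by simpa using (Metric.mem_ball.1 hs).le
      have hez := abs_real_inner_le_norm e z
      have h1 : Real.exp (s * inner ℝ e z - s ^ 2 * ‖e‖ ^ 2 / 2) ≤ Real.exp (‖e‖ * ‖z‖) := by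
        gcongr
        have h2 : s * inner ℝ e z ≤ |s| * |inner ℝ e z| := by
          rw [← abs_mul]; exact le_abs_self _
        have h3 : |s| * |inner ℝ e z| ≤ 1 * (‖e‖ * ‖z‖) := by gcongr
        nlinarith [sq_nonneg (s * ‖e‖)]
      have h2 : |inner ℝ e z - s * ‖e‖ ^ 2| ≤ ‖e‖ * ‖z‖ + ‖e‖ ^ 2 := by
        refine (abs_sub _ _).trans ?_
        rw [abs_mul, abs_of_nonneg (sq_nonneg ‖e‖)]
        nlinarith [sq_nonneg ‖e‖]
      rw [norm_mul, norm_mul, Real.norm_eq_abs, Real.norm_eq_abs, Real.norm_eq_abs, Real.abs_exp]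
      calc _ ≤ Real.exp (‖e‖ * ‖z‖) * (‖e‖ * ‖z‖ + ‖e‖ ^ 2) * (C * (1 + ‖z‖ ^ 2)) := by
            gcongr; exact hb z
        _ = C * ((1 + ‖z‖ ^ 2) * (‖e‖ * ‖z‖ + ‖e‖ ^ 2)) * Real.exp (‖e‖ * ‖z‖) := by ring
        _ ≤ C * (2 * (‖e‖ + ‖e‖ ^ 2) * Real.exp (2 * ‖z‖)) * Real.exp (‖e‖ * ‖z‖) := by
            exact mul_le_mul_of_nonneg_right
              (mul_le_mul_of_nonneg_left (hpoly _ (norm_nonneg z)) hC) (Real.exp_pos _).le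
        _ = _ := by rw [add_mul, Real.exp_add]; ring)
    (integrable_stdGaussian_of_norm_le_exp (K := C * (2 * (‖e‖ + ‖e‖ ^ 2))) (c := 2 + ‖e‖)
      (Continuous.aestronglyMeasurable (by fun_prop))
      fun z => by rw [Real.norm_of_nonneg (by positivity)])
    (ae_of_all _ fun z s _ => hexp z s)
  have heq : (fun s : ℝ => ∫ z, φ (s • e + z) ∂(stdGaussian E)) = fun s : ℝ =>
      ∫ z, Real.exp (s * inner ℝ e z - s ^ 2 * ‖e‖ ^ 2 / 2) * φ z ∂(stdGaussian E) := by
    funext s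
    rw [integral_add_left_stdGaussian]
    simp_rw [real_inner_smul_left, norm_smul, mul_pow, Real.norm_eq_abs, sq_abs]
  have h := hL.2.unique (heq ▸ hR.2)
  simpa using h.symm

end Gaussian

/-! ### Evidence and posterior moments in the Gaussian channel -/

section Posterior

variable {E : Type*} [NormedAddCommGroup E] [InnerProductSpace ℝ E]

/-- The density at `z`, relative to the standard Gaussian, of a standard Gaussian shifted
by `a • x`. -/
def tilt (a : ℝ) (z x : E) : ℝ := Real.exp (a * inner ℝ z x - a ^ 2 * ‖x‖ ^ 2 / 2)

theorem tilt_pos (a : ℝ) (z x : E) : 0 < tilt a z x := Real.exp_pos _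

/-- Completing the square. In this form the tilt is visibly bounded in `x`, so it preserves
integrability. -/
theorem tilt_eq (a : ℝ) (z x : E) :
    tilt a z x = Real.exp (‖z‖ ^ 2 / 2 - ‖z - a • x‖ ^ 2 / 2) := by
  rw [tilt, norm_sub_sq_real, norm_smul, real_inner_smul_right, mul_pow, Real.norm_eq_abs, sq_abs]
  congr 1; ring

theorem tilt_le (a : ℝ) (z x : E) : tilt a z x ≤ Real.exp (‖z‖ ^ 2 / 2) := by
  rw [tilt_eq]
  gcongr
  linarith [sq_nonneg ‖z - a • x‖]

theorem tilt_le_of_norm_le {a c : ℝ} {z : E} (hz : ‖z‖ ≤ c) (x : E) :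
    tilt a z x ≤ Real.exp (c ^ 2 / 2) := by
  refine (tilt_le a z x).trans ?_
  gcongr

@[fun_prop]
theorem continuous_tilt {S : Type*} [TopologicalSpace S] {a : S → ℝ} {z x : S → E}
    (ha : Continuous a) (hz : Continuous z) (hx : Continuous x) :
    Continuous fun s => tilt (a s) (z s) (x s) := by
  unfold tilt; fun_prop

variable [MeasurableSpace E]

/-- The density at `z`, relative to the standard Gaussian, of the law of `a • X + N` for
`X ∼ B` and an independent standard Gaussian `N`. -/
def evidence (B : Measure E) (a : ℝ) (z : E) : ℝ := ∫ x, tilt a z x ∂B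

/-- The posterior mean of `X` given `a • X + N = z`. -/
def postMean (B : Measure E) (a : ℝ) (z : E) : E :=
  (evidence B a z)⁻¹ • ∫ x, tilt a z x • x ∂B

/-- The posterior second moment of `X` given `a • X + N = z`. -/
def postSq (B : Measure E) (a : ℝ) (z : E) : ℝ :=
  (evidence B a z)⁻¹ * ∫ x, tilt a z x * ‖x‖ ^ 2 ∂B

variable [FiniteDimensional ℝ E] [BorelSpace E]

theorem aestronglyMeasurable_tilt (B : Measure E) (a : ℝ) (z : E) :
    AEStronglyMeasurable (fun x => tilt a z x) B :=
  Continuous.aestronglyMeasurable (by fun_prop)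

theorem integrable_tilt_smul {B : Measure E} {F : Type*} [NormedAddCommGroup F] [NormedSpace ℝ F]
    (a : ℝ) (z : E) {f : E → F} (hf : Integrable f B) :
    Integrable (fun x => tilt a z x • f x) B := by
  refine (hf.norm.const_mul (Real.exp (‖z‖ ^ 2 / 2))).mono'
    ((aestronglyMeasurable_tilt B a z).smul hf.1) (ae_of_all _ fun x => ?_)
  rw [norm_smul, Real.norm_of_nonneg (tilt_pos a z x).le]
  gcongr
  exact tilt_le a z x

theorem integrable_tilt_mul {B : Measure E} (a : ℝ) (z : E) {f : E → ℝ} (hf : Integrable f B) :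
    Integrable (fun x => tilt a z x * f x) B := integrable_tilt_smul a z hf

theorem measurable_evidence (B : Measure E) [SFinite B] :
    Measurable fun p : ℝ × E => evidence B p.1 p.2 := by
  have : StronglyMeasurable (fun q : (ℝ × E) × E => tilt q.1.1 q.1.2 q.2) :=
    Continuous.stronglyMeasurable (by fun_prop)
  exact this.integral_prod_right.measurable

theorem measurable_postMean (B : Measure E) [SFinite B] :
    Measurable fun p : ℝ × E => postMean B p.1 p.2 := by
  have : StronglyMeasurable (fun q : (ℝ × E) × E => tilt q.1.1 q.1.2 q.2 • q.2) :=
    Continuous.stronglyMeasurable (by fun_prop)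
  exact (measurable_evidence B).inv.smul this.integral_prod_right.measurable

theorem measurable_postSq (B : Measure E) [SFinite B] :
    Measurable fun p : ℝ × E => postSq B p.1 p.2 := by
  have : StronglyMeasurable (fun q : (ℝ × E) × E => tilt q.1.1 q.1.2 q.2 * ‖q.2‖ ^ 2) :=
    Continuous.stronglyMeasurable (by fun_prop)
  exact (measurable_evidence B).inv.mul this.integral_prod_right.measurable

@[fun_prop]
theorem measurable_evidence_comp {S : Type*} [MeasurableSpace S] (B : Measure E) [SFinite B]
    {a : S → ℝ} {z : S → E} (ha : Measurable a) (hz : Measurable z) :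
    Measurable fun s => evidence B (a s) (z s) :=
  (measurable_evidence B).comp (ha.prodMk hz)

@[fun_prop]
theorem measurable_postMean_comp {S : Type*} [MeasurableSpace S] (B : Measure E) [SFinite B]
    {a : S → ℝ} {z : S → E} (ha : Measurable a) (hz : Measurable z) :
    Measurable fun s => postMean B (a s) (z s) :=
  (measurable_postMean B).comp (ha.prodMk hz)

@[fun_prop]
theorem measurable_postSq_comp {S : Type*} [MeasurableSpace S] (B : Measure E) [SFinite B]
    {a : S → ℝ} {z : S → E} (ha : Measurable a) (hz : Measurable z) :
    Measurable fun s => postSq B (a s) (z s) :=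
  (measurable_postSq B).comp (ha.prodMk hz)

variable (B : Measure E) [IsProbabilityMeasure B]

theorem integrable_tilt (a : ℝ) (z : E) : Integrable (fun x => tilt a z x) B := by
  simpa using integrable_tilt_mul a z (integrable_const (1 : ℝ) (μ := B))

theorem evidence_le (a : ℝ) (z : E) : evidence B a z ≤ Real.exp (‖z‖ ^ 2 / 2) := by
  have h := integral_mono (integrable_tilt B a z) (integrable_const (Real.exp (‖z‖ ^ 2 / 2)))
    fun x => tilt_le a z x
  simpa [evidence] using h

theorem evidence_zero (z : E) : evidence B 0 z = 1 := by simp [evidence, tilt]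

theorem exists_measure_closedBall_pos :
    ∃ r : ℝ, 0 ≤ r ∧ 0 < B.real (Metric.closedBall 0 r) := by
  by_contra! hcon
  have h0 : ∀ n : ℕ, B (Metric.closedBall (0 : E) n) = 0 := fun n => by
    have h1 := hcon n (Nat.cast_nonneg n)
    have h2 := measureReal_nonneg.antisymm' h1
    rwa [measureReal_eq_zero_iff] at h2
  have h1 : B (⋃ n : ℕ, Metric.closedBall (0 : E) n) = 0 := measure_iUnion_null h0
  rw [Metric.iUnion_closedBall_nat] at h1
  simp at h1

/-- On the ball of radius r one has ‖z - a x‖ ≤ ‖z‖ + βr, which bounds the tilt from below. With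
`evidence_le` this makes the log-evidence grow at most quadratically in `z`, uniformly for |a| ≤ β.
-/
theorem evidence_ge {a β r : ℝ} (ha : |a| ≤ β) (z : E) :
    B.real (Metric.closedBall 0 r) * Real.exp (‖z‖ ^ 2 / 2 - (‖z‖ + β * r) ^ 2 / 2) ≤
      evidence B a z := by
  have hβ : 0 ≤ β := (abs_nonneg a).trans ha
  have h1 : ∀ x ∈ Metric.closedBall (0 : E) r,
      Real.exp (‖z‖ ^ 2 / 2 - (‖z‖ + β * r) ^ 2 / 2) ≤ tilt a z x := by
    intro x hx
    have hx' : ‖x‖ ≤ r := by simpa using hx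
    rw [tilt_eq]
    gcongr
    refine (norm_sub_le _ _).trans ?_
    rw [norm_smul, Real.norm_eq_abs]
    gcongr
  calc _ = ∫ x in Metric.closedBall (0 : E) r,
        Real.exp (‖z‖ ^ 2 / 2 - (‖z‖ + β * r) ^ 2 / 2) ∂B := by
        rw [setIntegral_const, smul_eq_mul]
    _ ≤ ∫ x in Metric.closedBall (0 : E) r, tilt a z x ∂B :=
        setIntegral_mono_on (integrable_const _).integrableOn (integrable_tilt B a z).integrableOn
          Metric.isClosed_closedBall.measurableSet h1
    _ ≤ _ := setIntegral_le_integral (integrable_tilt B a z)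
        (ae_of_all _ fun x => (tilt_pos a z x).le)

theorem evidence_pos (a : ℝ) (z : E) : 0 < evidence B a z := by
  obtain ⟨r, -, hpos⟩ := exists_measure_closedBall_pos B
  exact (by positivity : (0 : ℝ) < _).trans_le (evidence_ge B le_rfl z)

theorem exists_abs_log_evidence_le (β : ℝ) :
    ∃ C, ∀ a, |a| ≤ β → ∀ z, |Real.log (evidence B a z)| ≤ C * (1 + ‖z‖ ^ 2) := by
  obtain ⟨r, hr, hpos⟩ := exists_measure_closedBall_pos B
  refine ⟨|Real.log (B.real (Metric.closedBall 0 r))| + (β * r) ^ 2 + 1, fun a ha z => ?_⟩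
  have hβ : 0 ≤ β := (abs_nonneg a).trans ha
  have h1 := Real.log_le_log (evidence_pos B a z) (evidence_le B a z)
  have h2 := Real.log_le_log (by positivity) (evidence_ge B ha z)
  rw [Real.log_exp] at h1
  rw [Real.log_mul hpos.ne' (Real.exp_pos _).ne', Real.log_exp] at h2
  have h3 := neg_abs_le (Real.log (B.real (Metric.closedBall (0 : E) r)))
  have h4 := abs_nonneg (Real.log (B.real (Metric.closedBall (0 : E) r)))
  set l := |Real.log (B.real (Metric.closedBall (0 : E) r))|
  have h5 : 0 ≤ l * ‖z‖ ^ 2 := by positivity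
  have h6 : 0 ≤ (β * r) ^ 2 * ‖z‖ ^ 2 := by positivity
  rw [abs_le]
  constructor <;> nlinarith [sq_nonneg (‖z‖ - β * r), sq_nonneg (β * r)]

variable {B}

theorem integrable_of_integrable_sq (hB : Integrable (fun x => ‖x‖ ^ 2) B) :
    Integrable (fun x : E => x) B := by
  refine ((integrable_const 1).add hB).mono' (Continuous.aestronglyMeasurable (by fun_prop))
    (ae_of_all _ fun x => ?_)
  simp only [Pi.add_apply]
  nlinarith [sq_nonneg (‖x‖ - 1)]

/-- Split at the radius K = (2‖z‖ + βr)/α. Inside, ‖x‖² ≤ K². Outside, ‖z - a x‖ ≥ ‖z‖ + βr, so the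
tilt is at most ε, and bε is at most the evidence by `evidence_ge`. The bound is uniform on compact
ranges of positive strengths, as differentiation under the integral requires. -/
theorem exists_postSq_le (hB : Integrable (fun x => ‖x‖ ^ 2) B) {α : ℝ} (hα : 0 < α) (β : ℝ) :
    ∃ C, ∀ a ∈ Set.Icc α β, ∀ z, postSq B a z ≤ C * (1 + ‖z‖ ^ 2) := by
  obtain ⟨r, hr, hpos⟩ := exists_measure_closedBall_pos B
  set b := B.real (Metric.closedBall 0 r) with hb
  set m := ∫ x, ‖x‖ ^ 2 ∂B with hm
  have hm0 : 0 ≤ m := integral_nonneg fun x => by positivity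
  refine ⟨(8 + 2 * (β * r) ^ 2) / α ^ 2 + m / b, fun a ha z => ?_⟩
  have ha0 : 0 < a := hα.trans_le ha.1
  have hβ : 0 ≤ β := (ha0.trans_le ha.2).le
  set K := (2 * ‖z‖ + β * r) / α with hK
  set ε := Real.exp (‖z‖ ^ 2 / 2 - (‖z‖ + β * r) ^ 2 / 2) with hε
  have hR := evidence_ge B (r := r) ((abs_of_pos ha0).trans_le ha.2) z
  have hpt : ∀ x : E, tilt a z x * ‖x‖ ^ 2 ≤ K ^ 2 * tilt a z x + ε * ‖x‖ ^ 2 := by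
    intro x
    rcases le_total ‖x‖ K with h | h
    · have : ‖x‖ ^ 2 ≤ K ^ 2 := by gcongr
      have h0 : 0 ≤ ε * ‖x‖ ^ 2 := by positivity
      nlinarith [tilt_pos a z x]
    · have h1 : tilt a z x ≤ ε := by
        rw [tilt_eq, hε]
        gcongr
        rw [hK, div_le_iff₀ hα] at h
        have h2 : ‖a • x‖ - ‖z‖ ≤ ‖z - a • x‖ := by
          rw [norm_sub_rev]; exact norm_sub_norm_le _ _
        rw [norm_smul, Real.norm_of_nonneg ha0.le] at h2
        nlinarith [mul_le_mul_of_nonneg_right ha.1 (norm_nonneg x)]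
      have h0 : 0 ≤ K ^ 2 * tilt a z x := mul_nonneg (sq_nonneg _) (tilt_pos a z x).le
      nlinarith [mul_le_mul_of_nonneg_right h1 (sq_nonneg ‖x‖)]
  have hint := integral_mono (integrable_tilt_mul a z hB)
    (((integrable_tilt B a z).const_mul (K ^ 2)).add (hB.const_mul ε)) hpt
  simp only [Pi.add_apply] at hint
  rw [integral_add ((integrable_tilt B a z).const_mul _) (hB.const_mul _), integral_const_mul,
    integral_const_mul, ← hm] at hint
  change _ ≤ K ^ 2 * evidence B a z + _ at hint
  have hε' : ε * m ≤ m / b * evidence B a z := by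
    rw [div_mul_eq_mul_div, le_div_iff₀ hpos]
    calc ε * m * b = m * (b * ε) := by ring
      _ ≤ _ := by gcongr
  have hRp := evidence_pos B a z
  have h1 : postSq B a z ≤ K ^ 2 + m / b := by
    rw [postSq, inv_mul_le_iff₀ hRp]
    linarith
  have h2 : K ^ 2 ≤ (8 + 2 * (β * r) ^ 2) / α ^ 2 * (1 + ‖z‖ ^ 2) := by
    rw [hK, div_pow, div_mul_eq_mul_div]
    gcongr
    nlinarith [sq_nonneg (2 * ‖z‖ - β * r), sq_nonneg (β * r * ‖z‖)]
  have h3 : 0 ≤ m / b * ‖z‖ ^ 2 := by positivity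
  nlinarith

theorem inner_postMean (hB : Integrable (fun x => ‖x‖ ^ 2) B) (a : ℝ) (z e : E) :
    inner ℝ e (postMean B a z) = (evidence B a z)⁻¹ * ∫ x, tilt a z x * inner ℝ e x ∂B := by
  rw [postMean, real_inner_smul_right,
    ← integral_inner (integrable_tilt_smul a z (integrable_of_integrable_sq hB))]
  simp_rw [real_inner_smul_right]

/-- Nonnegativity of the posterior variance. -/
theorem norm_postMean_sq_le (hB : Integrable (fun x => ‖x‖ ^ 2) B) (a : ℝ) (z : E) :
    ‖postMean B a z‖ ^ 2 ≤ postSq B a z := by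
  set D := postMean B a z with hD
  have hRp := evidence_pos B a z
  have hi := integrable_of_integrable_sq hB
  have hi1 := (integrable_tilt_mul a z ((hi.const_inner D).const_mul 2))
  have hi2 := (integrable_tilt B a z).mul_const (‖D‖ ^ 2)
  have h0 : 0 ≤ ∫ x, tilt a z x * ‖x - D‖ ^ 2 ∂B :=
    integral_nonneg fun x => mul_nonneg (tilt_pos a z x).le (sq_nonneg _)
  have h1 : ∫ x, tilt a z x * ‖x - D‖ ^ 2 ∂B =
      (∫ x, tilt a z x * ‖x‖ ^ 2 ∂B) - 2 * (∫ x, tilt a z x * inner ℝ D x ∂B) +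
        evidence B a z * ‖D‖ ^ 2 := by
    rw [evidence, ← integral_mul_const, ← integral_const_mul, ← integral_sub
      (integrable_tilt_mul a z hB), ← integral_add]
    · refine integral_congr_ae (ae_of_all _ fun x => ?_)
      simp only
      rw [norm_sub_sq_real, real_inner_comm]; ring
    · refine ((integrable_tilt_mul a z hB).sub hi1).congr (ae_of_all _ fun x => ?_)
      simp; ring
    · exact hi2
    · refine hi1.congr (ae_of_all _ fun x => ?_)
      simp; ring
  have h2 := inner_postMean hB a z D
  rw [← hD, real_inner_self_eq_norm_sq, eq_inv_mul_iff_mul_eq₀ hRp.ne'] at h2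
  rw [h1, ← h2] at h0
  rw [postSq, le_inv_mul_iff₀ hRp]
  linarith

/-- Differentiation of weighted evidence integrals in the observation. -/
theorem hasDerivAt_integral_tilt (a : ℝ) (z e : E) {w : E → ℝ} (hw : Integrable w B)
    (hw' : Integrable (fun x => ‖x‖ * w x) B) :
    HasDerivAt (fun s : ℝ => ∫ x, tilt a (z + s • e) x * w x ∂B)
      (∫ x, tilt a z x * (a * inner ℝ e x * w x) ∂B) 0 := by
  have hd : ∀ (x : E) (s : ℝ), HasDerivAt (fun s : ℝ => tilt a (z + s • e) x * w x)
      (tilt a (z + s • e) x * (a * inner ℝ e x * w x)) s := by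
    intro x s
    have h1 : HasDerivAt (fun s : ℝ => a * inner ℝ (z + s • e) x - a ^ 2 * ‖x‖ ^ 2 / 2)
        (a * inner ℝ e x) s := by
      simp_rw [inner_add_left, real_inner_smul_left]
      have := ((((hasDerivAt_id s).mul_const (inner ℝ e x)).const_add (inner ℝ z x)).const_mul
        a).sub_const (a ^ 2 * ‖x‖ ^ 2 / 2)
      simpa using this
    refine (h1.exp.mul_const (w x)).congr_deriv ?_
    rw [tilt]; ring
  have hwm : AEStronglyMeasurable w B := hw.1
  have h := hasDerivAt_integral_of_dominated_loc_of_deriv_le (μ := B)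
    (F := fun (s : ℝ) x => tilt a (z + s • e) x * w x)
    (F' := fun s x => tilt a (z + s • e) x * (a * inner ℝ e x * w x)) (x₀ := 0)
    (s := Metric.ball 0 1)
    (bound := fun x => Real.exp ((‖z‖ + ‖e‖) ^ 2 / 2) * (|a| * ‖e‖) * ‖‖x‖ * w x‖)
    (Metric.ball_mem_nhds _ one_pos)
    (Filter.Eventually.of_forall fun s => (aestronglyMeasurable_tilt B _ _).mul hwm)
    (integrable_tilt_mul a _ hw)
    ((aestronglyMeasurable_tilt B _ _).mul
      ((Continuous.aestronglyMeasurable (by fun_prop)).mul hwm))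
    (ae_of_all _ fun x s hs => by
      have hs1 : |s| ≤ 1 := by simpa using (Metric.mem_ball.1 hs).le
      have hz : ‖z + s • e‖ ≤ ‖z‖ + ‖e‖ := by
        refine (norm_add_le _ _).trans ?_
        rw [norm_smul, Real.norm_eq_abs]
        nlinarith [norm_nonneg e]
      rw [norm_mul, norm_mul, norm_mul, norm_mul, Real.norm_of_nonneg (tilt_pos _ _ _).le,
        norm_norm, Real.norm_eq_abs a]
      calc _ ≤ Real.exp ((‖z‖ + ‖e‖) ^ 2 / 2) * (|a| * (‖e‖ * ‖x‖) * ‖w x‖) := by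
            gcongr
            · exact tilt_le_of_norm_le hz x
            · exact norm_inner_le_norm e x
        _ = _ := by ring)
    (hw'.norm.const_mul _)
    (ae_of_all _ fun x s _ => hd x s)
  simpa using h.2

/-- The weight 1 in `hasDerivAt_integral_tilt`: Tweedie's formula, in directional form. -/
theorem hasDerivAt_evidence_line (hB : Integrable (fun x => ‖x‖ ^ 2) B) (a : ℝ) (z e : E) :
    HasDerivAt (fun s : ℝ => evidence B a (z + s • e))
      (a * (evidence B a z * inner ℝ e (postMean B a z))) 0 := by
  have h := hasDerivAt_integral_tilt (B := B) a z e (w := fun _ => 1) (integrable_const _)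
    (by simpa using (integrable_of_integrable_sq hB).norm)
  simp only [mul_one] at h
  refine h.congr_deriv ?_
  rw [inner_postMean hB, mul_inv_cancel_left₀ (evidence_pos B a z).ne', ← integral_const_mul]
  exact integral_congr_ae (ae_of_all _ fun x => by simp only; ring)

/-- The derivative of the posterior mean in the observation is `a` times the posterior
covariance. -/
theorem hasDerivAt_inner_postMean_line (hB : Integrable (fun x => ‖x‖ ^ 2) B) (a : ℝ) (z e : E) :
    HasDerivAt (fun s : ℝ => inner ℝ e (postMean B a (z + s • e)))
      (a * ((evidence B a z)⁻¹ * (∫ x, tilt a z x * inner ℝ e x ^ 2 ∂B) -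
        inner ℝ e (postMean B a z) ^ 2)) 0 := by
  have hRp := evidence_pos B a z
  have hi := integrable_of_integrable_sq hB
  have h1 := hasDerivAt_evidence_line hB a z e
  have h2 := hasDerivAt_integral_tilt (B := B) a z e (w := fun x => inner ℝ e x)
    (hi.const_inner e) (by
      refine (hB.const_mul ‖e‖).mono' (Continuous.aestronglyMeasurable (by fun_prop))
        (ae_of_all _ fun x => ?_)
      rw [norm_mul, norm_norm]
      nlinarith [norm_inner_le_norm (𝕜 := ℝ) e x, norm_nonneg x])
  have h3 := h2.fun_div h1 (by simpa using hRp.ne')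
  have h4 : (fun s : ℝ => inner ℝ e (postMean B a (z + s • e))) = fun s : ℝ =>
      (∫ x, tilt a (z + s • e) x * inner ℝ e x ∂B) / evidence B a (z + s • e) := by
    funext s
    rw [inner_postMean hB, inv_mul_eq_div]
  rw [h4]
  refine h3.congr_deriv ?_
  have h5 := inner_postMean hB a z e
  rw [eq_inv_mul_iff_mul_eq₀ hRp.ne'] at h5
  have h6 : ∫ x, tilt a z x * (a * inner ℝ e x * inner ℝ e x) ∂B =
      a * ∫ x, tilt a z x * inner ℝ e x ^ 2 ∂B := by
    rw [← integral_const_mul]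
    exact integral_congr_ae (ae_of_all _ fun x => by simp only; ring)
  simp only [zero_smul, add_zero]
  rw [h6, ← h5]
  field_simp

/-- Derivative of the evidence along the path `a ↦ a • x + n`. -/
theorem hasDerivAt_evidence_path (hB : Integrable (fun x => ‖x‖ ^ 2) B) (a : ℝ) (x n : E) :
    HasDerivAt (fun a : ℝ => evidence B a (a • x + n))
      (evidence B a (a • x + n) * (inner ℝ (n + (2 * a) • x) (postMean B a (a • x + n)) -
        a * postSq B a (a • x + n))) a := by
  have hi := integrable_of_integrable_sq hB
  have hd : ∀ (x' : E) (a : ℝ), HasDerivAt (fun a : ℝ => tilt a (a • x + n) x')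
      (tilt a (a • x + n) x' * (inner ℝ (n + (2 * a) • x) x' - a * ‖x'‖ ^ 2)) a := by
    intro x' a
    have h1 : HasDerivAt (fun a : ℝ => a * inner ℝ (a • x + n) x' - a ^ 2 * ‖x'‖ ^ 2 / 2)
        (inner ℝ (n + (2 * a) • x) x' - a * ‖x'‖ ^ 2) a := by
      simp_rw [inner_add_left, real_inner_smul_left]
      have := (((hasDerivAt_id a).mul (((hasDerivAt_id a).mul_const (inner ℝ x x')).add_const
        (inner ℝ n x')))).sub ((((hasDerivAt_id a).pow 2).mul_const (‖x'‖ ^ 2)).div_const 2)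
      refine this.congr_deriv ?_
      simp; ring
    exact h1.exp
  set c := |a| + 1 with hc
  have hc0 : 0 ≤ c := by positivity
  have h := hasDerivAt_integral_of_dominated_loc_of_deriv_le (μ := B)
    (F := fun (a : ℝ) x' => tilt a (a • x + n) x')
    (F' := fun a x' => tilt a (a • x + n) x' * (inner ℝ (n + (2 * a) • x) x' - a * ‖x'‖ ^ 2))
    (x₀ := a) (s := Metric.ball a 1)
    (bound := fun x' => Real.exp ((c * ‖x‖ + ‖n‖) ^ 2 / 2) *
      ((‖n‖ + 2 * c * ‖x‖) * ‖x'‖ + c * ‖x'‖ ^ 2))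
    (Metric.ball_mem_nhds _ one_pos)
    (Filter.Eventually.of_forall fun s => aestronglyMeasurable_tilt B _ _)
    (integrable_tilt B _ _)
    (Continuous.aestronglyMeasurable (by fun_prop))
    (ae_of_all _ fun x' s hs => by
      have hs1 : |s| ≤ c := by
        have h1 : |s - a| < 1 := hs
        have h2 := abs_sub_abs_le_abs_sub s a
        linarith
      have hz : ‖s • x + n‖ ≤ c * ‖x‖ + ‖n‖ := by
        refine (norm_add_le _ _).trans ?_
        rw [norm_smul, Real.norm_eq_abs]
        gcongr
      rw [norm_mul, Real.norm_of_nonneg (tilt_pos _ _ _).le]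
      gcongr
      · exact tilt_le_of_norm_le hz x'
      · refine (norm_sub_le _ _).trans ?_
        rw [norm_mul, Real.norm_of_nonneg (sq_nonneg ‖x'‖), Real.norm_eq_abs s]
        gcongr
        refine (norm_inner_le_norm _ _).trans ?_
        gcongr
        refine (norm_add_le _ _).trans ?_
        rw [norm_smul, norm_mul, Real.norm_eq_abs s, Real.norm_of_nonneg (by norm_num : (0:ℝ) ≤ 2)]
        gcongr)
    (((hi.norm.const_mul _).add (hB.const_mul _)).const_mul _)
    (ae_of_all _ fun x' s _ => hd x' s)
  refine h.2.congr_deriv ?_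
  have hRp := evidence_pos B a (a • x + n)
  rw [inner_postMean hB, postSq, mul_sub, mul_inv_cancel_left₀ hRp.ne', mul_left_comm _ a,
    mul_inv_cancel_left₀ hRp.ne', ← integral_const_mul, ← integral_sub]
  · exact integral_congr_ae (ae_of_all _ fun x' => by simp only; ring)
  · exact integrable_tilt_mul _ _ (hi.const_inner _)
  · exact (integrable_tilt_mul _ _ hB).const_mul _

/-- Strength and observation move together while signal and noise stay fixed. The expected
log-evidence is then an integral against a fixed law and can be differentiated under the integral
sign. -/
theorem hasDerivAt_log_evidence_path (hB : Integrable (fun x => ‖x‖ ^ 2) B) (a : ℝ) (x n : E) :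
    HasDerivAt (fun a : ℝ => Real.log (evidence B a (a • x + n)))
      (inner ℝ (n + (2 * a) • x) (postMean B a (a • x + n)) - a * postSq B a (a • x + n)) a := by
  have hRp := evidence_pos B a (a • x + n)
  refine ((hasDerivAt_evidence_path hB a x n).log hRp.ne').congr_deriv ?_
  rw [mul_div_cancel_left₀ _ hRp.ne']

end Posterior

/-! ### The derivative of the smoothed divergence in the signal strength -/

section Channel

variable {E : Type*} [NormedAddCommGroup E] [InnerProductSpace ℝ E] [FiniteDimensional ℝ E]
  [MeasurableSpace E] [BorelSpace E]

theorem one_add_norm_add_sq_le (h n : E) :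
    1 + ‖h + n‖ ^ 2 ≤ (2 + 2 * ‖h‖ ^ 2) * (1 + ‖n‖ ^ 2) := by
  have h1 : ‖h + n‖ ^ 2 ≤ (‖h‖ + ‖n‖) ^ 2 := by gcongr; exact norm_add_le _ _
  nlinarith [sq_nonneg (‖h‖ - ‖n‖), sq_nonneg ‖n‖, sq_nonneg (‖h‖ * ‖n‖)]

theorem one_add_norm_path_sq_le {a β : ℝ} (ha : |a| ≤ β) (x n : E) :
    1 + ‖a • x + n‖ ^ 2 ≤ (2 + 2 * β ^ 2) * (1 + (‖x‖ ^ 2 + ‖n‖ ^ 2)) := by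
  have hβ : 0 ≤ β := (abs_nonneg a).trans ha
  have h1 : ‖a • x + n‖ ≤ β * ‖x‖ + ‖n‖ := by
    refine (norm_add_le _ _).trans ?_
    rw [norm_smul, Real.norm_eq_abs]
    gcongr
  have h2 : ‖a • x + n‖ ^ 2 ≤ (β * ‖x‖ + ‖n‖) ^ 2 := by gcongr
  nlinarith [sq_nonneg (β * ‖x‖ - ‖n‖), sq_nonneg (β * ‖n‖), sq_nonneg β, sq_nonneg ‖x‖]

variable {A B : Measure E} [IsProbabilityMeasure A] [IsProbabilityMeasure B]

theorem integrable_prod_sq (hA : Integrable (fun x => ‖x‖ ^ 2) A) (C : ℝ) :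
    Integrable (fun p : E × E => C * (1 + (‖p.1‖ ^ 2 + ‖p.2‖ ^ 2))) (A.prod (stdGaussian E)) := by
  have h2 : Integrable (fun z : E => ‖z‖ ^ 2) (stdGaussian E) :=
    IsGaussian.memLp_two_id.integrable_norm_pow (by norm_num)
  exact ((integrable_const 1).add ((hA.comp_fst _).add (h2.comp_snd _))).const_mul C

theorem integrable_prod_of_le_sq (hA : Integrable (fun x => ‖x‖ ^ 2) A) {f : E × E → ℝ}
    (hf : Measurable f) {C : ℝ} (h : ∀ p, |f p| ≤ C * (1 + (‖p.1‖ ^ 2 + ‖p.2‖ ^ 2))) :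
    Integrable f (A.prod (stdGaussian E)) :=
  (integrable_prod_sq hA C).mono' hf.aestronglyMeasurable (ae_of_all _ h)

theorem postSq_nonneg (a : ℝ) (z : E) : 0 ≤ postSq B a z :=
  mul_nonneg (inv_nonneg.2 (evidence_pos B a z).le)
    (integral_nonneg fun x => mul_nonneg (tilt_pos a z x).le (sq_nonneg _))

theorem exists_norm_postMean_sq_le (hB : Integrable (fun x => ‖x‖ ^ 2) B) {a : ℝ} (ha : 0 < a) :
    ∃ C, 0 ≤ C ∧ ∀ x n, ‖postMean B a (a • x + n)‖ ^ 2 ≤ C * (1 + (‖x‖ ^ 2 + ‖n‖ ^ 2)) := by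
  obtain ⟨C, hC⟩ := exists_postSq_le hB ha a
  have hC0 : 0 ≤ C := by
    simpa using (postSq_nonneg (B := B) a 0).trans (hC a ⟨le_rfl, le_rfl⟩ 0)
  refine ⟨C * (2 + 2 * a ^ 2), by positivity, fun x n => ?_⟩
  refine ((norm_postMean_sq_le hB a _).trans (hC a ⟨le_rfl, le_rfl⟩ _)).trans ?_
  rw [mul_assoc]
  gcongr
  exact one_add_norm_path_sq_le (abs_of_pos ha).le x n

/-- Stein's identity in each direction of an orthonormal basis. The derivative of the posterior mean
is `a` times the posterior covariance, whose trace is the posterior second moment minus the squared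
norm of the mean. -/
theorem integral_inner_postMean_stdGaussian (hB : Integrable (fun x => ‖x‖ ^ 2) B) {a : ℝ}
    (ha : 0 < a) (h : E) :
    ∫ n, inner ℝ n (postMean B a (h + n)) ∂(stdGaussian E) =
      a * ∫ n, (postSq B a (h + n) - ‖postMean B a (h + n)‖ ^ 2) ∂(stdGaussian E) := by
  set b := stdOrthonormalBasis ℝ E
  obtain ⟨C, hC⟩ := exists_postSq_le hB ha a
  replace hC := hC a ⟨le_rfl, le_rfl⟩
  have hC0 : 0 ≤ C := by simpa using (postSq_nonneg (B := B) a 0).trans (hC 0)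
  -- `Q e z` is the posterior mean of ⟨e, x⟩²; its sum over an orthonormal basis is `postSq`.
  set Q : E → E → ℝ := fun e z => (evidence B a z)⁻¹ * ∫ x, tilt a z x * inner ℝ e x ^ 2 ∂B with hQ
  have hQm : ∀ e, Measurable (Q e) := fun e => by
    have : StronglyMeasurable (fun q : E × E => tilt a q.1 q.2 * inner ℝ e q.2 ^ 2) :=
      Continuous.stronglyMeasurable (by fun_prop)
    exact (Measurable.inv (by fun_prop)).mul this.integral_prod_right.measurable
  have hsqi : ∀ e : E, Integrable (fun x => inner ℝ e x ^ 2) B := fun e => by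
    refine (hB.const_mul (‖e‖ ^ 2)).mono' (Continuous.aestronglyMeasurable (by fun_prop))
      (ae_of_all _ fun x => ?_)
    rw [Real.norm_of_nonneg (sq_nonneg _), ← mul_pow, ← sq_abs]
    gcongr
    exact abs_real_inner_le_norm e x
  have hQ0 : ∀ e z, 0 ≤ Q e z := fun e z => mul_nonneg (inv_nonneg.2 (evidence_pos B a z).le)
    (integral_nonneg fun x => mul_nonneg (tilt_pos a z x).le (sq_nonneg _))
  have hsumQ : ∀ z, ∑ i, Q (b i) z = postSq B a z := fun z => by
    rw [← Finset.mul_sum, postSq, ← integral_finsetSum _ fun i _ => integrable_tilt_mul a z (hsqi _)]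
    congr 1
    refine integral_congr_ae (ae_of_all _ fun x => ?_)
    simp only
    rw [← Finset.mul_sum, b.sum_sq_inner_right]
  have hsumD : ∀ z, ∑ i, inner ℝ (b i) (postMean B a z) ^ 2 = ‖postMean B a z‖ ^ 2 :=
    fun z => b.sum_sq_inner_right _
  have hQle : ∀ i z, Q (b i) z ≤ postSq B a z := fun i z => by
    rw [← hsumQ]
    exact Finset.single_le_sum (f := fun i => Q (b i) z) (fun j _ => hQ0 _ _) (Finset.mem_univ i)
  have hDle : ∀ i z, inner ℝ (b i) (postMean B a z) ^ 2 ≤ postSq B a z := fun i z => by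
    refine le_trans ?_ (norm_postMean_sq_le hB a z)
    rw [← hsumD]
    exact Finset.single_le_sum (f := fun i => inner ℝ (b i) (postMean B a z) ^ 2)
      (fun j _ => sq_nonneg _) (Finset.mem_univ i)
  have hMb : ∀ n, postSq B a (h + n) ≤ C * (2 + 2 * ‖h‖ ^ 2) * (1 + ‖n‖ ^ 2) := fun n => by
    refine (hC _).trans ?_
    rw [mul_assoc]
    gcongr
    exact one_add_norm_add_sq_le h n
  set C₁ := C * (2 + 2 * ‖h‖ ^ 2) with hC₁
  have hC₁0 : 0 ≤ C₁ := by positivity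
  have hφ'b : ∀ i n, |a * (Q (b i) (h + n) - inner ℝ (b i) (postMean B a (h + n)) ^ 2)| ≤
      (1 + a) * (1 + C₁) * (1 + ‖n‖ ^ 2) := fun i n => by
    have h1 : |Q (b i) (h + n) - inner ℝ (b i) (postMean B a (h + n)) ^ 2| ≤
        postSq B a (h + n) := by
      rw [abs_le]
      constructor <;>
        linarith [hQ0 (b i) (h + n), hQle i (h + n), hDle i (h + n),
          sq_nonneg (inner ℝ (b i) (postMean B a (h + n)))]
    rw [abs_mul, abs_of_pos ha, mul_assoc]
    have h2 : postSq B a (h + n) ≤ (1 + C₁) * (1 + ‖n‖ ^ 2) :=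
      (hMb n).trans (by gcongr; linarith)
    gcongr
    · linarith
    · linarith
  have hφb : ∀ i n, |inner ℝ (b i) (postMean B a (h + n))| ≤
      (1 + a) * (1 + C₁) * (1 + ‖n‖ ^ 2) := fun i n => by
    have h1 := abs_le_of_sq_le_sq (a := inner ℝ (b i) (postMean B a (h + n)))
      (b := 1 + C₁ * (1 + ‖n‖ ^ 2))
      (by nlinarith [(hDle i (h + n)).trans (hMb n), sq_nonneg (C₁ * (1 + ‖n‖ ^ 2)),
            mul_nonneg hC₁0 (by positivity : 0 ≤ 1 + ‖n‖ ^ 2)]) (by positivity)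
    refine h1.trans ?_
    have h3 : 1 + C₁ * (1 + ‖n‖ ^ 2) ≤ (1 + C₁) * (1 + ‖n‖ ^ 2) := by nlinarith [sq_nonneg ‖n‖]
    refine h3.trans ?_
    rw [mul_assoc (1 + a)]
    exact le_mul_of_one_le_left (by positivity) (by linarith)
  have hφm : ∀ i, Measurable fun n => inner ℝ (b i) (postMean B a (h + n)) := fun i => by
    fun_prop
  have hφ'm : ∀ i, Measurable fun n =>
      a * (Q (b i) (h + n) - inner ℝ (b i) (postMean B a (h + n)) ^ 2) := fun i => by
    have := hQm (b i)
    fun_prop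
  have hstein : ∀ i, ∫ n, inner ℝ (b i) n * inner ℝ (b i) (postMean B a (h + n)) ∂(stdGaussian E) =
      ∫ n, a * (Q (b i) (h + n) - inner ℝ (b i) (postMean B a (h + n)) ^ 2) ∂(stdGaussian E) := by
    intro i
    refine integral_inner_mul_stdGaussian (b i) (hφm i) (hφ'm i) (fun n => ?_) (hφb i) (hφ'b i)
    simpa only [add_assoc] using hasDerivAt_inner_postMean_line hB a (h + n) (b i)
  have hint : ∀ i, Integrable (fun n => inner ℝ (b i) n * inner ℝ (b i) (postMean B a (h + n)))
      (stdGaussian E) := fun i => by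
    refine integrable_stdGaussian_of_norm_le_sq (C := 1 + C₁)
      (Measurable.aestronglyMeasurable (by fun_prop)) fun n => ?_
    have h1 : inner ℝ (b i) n ^ 2 ≤ ‖n‖ ^ 2 := by
      rw [← b.sum_sq_inner_right n]
      exact Finset.single_le_sum (f := fun i => inner ℝ (b i) n ^ 2)
        (fun j _ => sq_nonneg _) (Finset.mem_univ i)
    have h2 := (hDle i (h + n)).trans (hMb n)
    rw [Real.norm_eq_abs, abs_le]
    constructor <;> nlinarith [sq_nonneg (inner ℝ (b i) n + inner ℝ (b i) (postMean B a (h + n))),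
      sq_nonneg (inner ℝ (b i) n - inner ℝ (b i) (postMean B a (h + n))), sq_nonneg ‖n‖]
  calc ∫ n, inner ℝ n (postMean B a (h + n)) ∂(stdGaussian E)
      = ∫ n, ∑ i, inner ℝ (b i) n * inner ℝ (b i) (postMean B a (h + n)) ∂(stdGaussian E) := by
        refine integral_congr_ae (ae_of_all _ fun n => ?_)
        simp only
        rw [← b.sum_inner_mul_inner]
        exact Finset.sum_congr rfl fun i _ => by rw [real_inner_comm]
    _ = ∑ i, ∫ n, a * (Q (b i) (h + n) - inner ℝ (b i) (postMean B a (h + n)) ^ 2)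
          ∂(stdGaussian E) := by
        rw [integral_finsetSum _ fun i _ => hint i]
        exact Finset.sum_congr rfl fun i _ => hstein i
    _ = ∫ n, ∑ i, a * (Q (b i) (h + n) - inner ℝ (b i) (postMean B a (h + n)) ^ 2)
          ∂(stdGaussian E) := by
        rw [integral_finsetSum _ fun i _ => ?_]
        exact integrable_stdGaussian_of_norm_le_sq (hφ'm i).aestronglyMeasurable (hφ'b i)
    _ = _ := by
        rw [← integral_const_mul]
        refine integral_congr_ae (ae_of_all _ fun n => ?_)
        simp only
        rw [← Finset.mul_sum, Finset.sum_sub_distrib, hsumQ, hsumD]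

/-- The expected log-evidence of `a • X + N` under the model `B`, when `X ∼ A`. -/
def expLogEvidence (A B : Measure E) (a : ℝ) : ℝ :=
  ∫ p, Real.log (evidence B a (a • p.1 + p.2)) ∂(A.prod (stdGaussian E))

theorem integrable_log_evidence (hA : Integrable (fun x => ‖x‖ ^ 2) A) (a : ℝ) :
    Integrable (fun p : E × E => Real.log (evidence B a (a • p.1 + p.2)))
      (A.prod (stdGaussian E)) := by
  obtain ⟨C, hC⟩ := exists_abs_log_evidence_le B |a|
  have hC0 : 0 ≤ C := by simpa using (abs_nonneg _).trans (hC a le_rfl 0)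
  refine integrable_prod_of_le_sq hA (by fun_prop) (C := C * (2 + 2 * |a| ^ 2)) fun p => ?_
  refine (hC a le_rfl _).trans ?_
  rw [mul_assoc]
  gcongr
  exact one_add_norm_path_sq_le le_rfl _ _

theorem expLogEvidence_zero : expLogEvidence A B 0 = 0 := by
  simp [expLogEvidence, evidence_zero]

/-- Used at a = 0, which the derivative formula for positive strengths does not cover; the
log-evidence bound is uniform near every strength. -/
theorem continuousAt_expLogEvidence (hA : Integrable (fun x => ‖x‖ ^ 2) A)
    (hB : Integrable (fun x => ‖x‖ ^ 2) B) (a : ℝ) : ContinuousAt (expLogEvidence A B) a := by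
  obtain ⟨C, hC⟩ := exists_abs_log_evidence_le B (|a| + 1)
  have hC0 : 0 ≤ C := by simpa using (abs_nonneg _).trans (hC a (by linarith) 0)
  refine continuousAt_of_dominated (bound := fun p : E × E =>
    C * (2 + 2 * (|a| + 1) ^ 2) * (1 + (‖p.1‖ ^ 2 + ‖p.2‖ ^ 2)))
    (Filter.Eventually.of_forall fun s => Measurable.aestronglyMeasurable (by fun_prop)) ?_
    (integrable_prod_sq hA _) (ae_of_all _ fun p =>
      (hasDerivAt_log_evidence_path hB a p.1 p.2).continuousAt)
  filter_upwards [Metric.ball_mem_nhds a one_pos] with s hs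
  refine ae_of_all _ fun p => ?_
  have hs1 : |s| ≤ |a| + 1 := by
    have h1 : |s - a| < 1 := hs
    have h2 := abs_sub_abs_le_abs_sub s a
    linarith
  refine (hC s hs1 _).trans ?_
  rw [mul_assoc]
  gcongr
  exact one_add_norm_path_sq_le hs1 _ _

theorem integrable_inner_postMean_path (hA : Integrable (fun x => ‖x‖ ^ 2) A)
    (hB : Integrable (fun x => ‖x‖ ^ 2) B) {a : ℝ} (ha : 0 < a) {f : E × E → E}
    (hf : Measurable f) {c : ℝ} (hfb : ∀ p, ‖f p‖ ^ 2 ≤ c * (1 + (‖p.1‖ ^ 2 + ‖p.2‖ ^ 2))) :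
    Integrable (fun p : E × E => inner ℝ (f p) (postMean B a (a • p.1 + p.2)))
      (A.prod (stdGaussian E)) := by
  obtain ⟨C, hC0, hC⟩ := exists_norm_postMean_sq_le hB ha
  refine integrable_prod_of_le_sq hA (by fun_prop) (C := c + C) fun p => ?_
  refine (abs_real_inner_le_norm _ _).trans ?_
  nlinarith [hfb p, hC p.1 p.2, sq_nonneg (‖f p‖ - ‖postMean B a (a • p.1 + p.2)‖),
    sq_nonneg ‖f p‖, sq_nonneg ‖postMean B a (a • p.1 + p.2)‖]

theorem integrable_norm_postMean_sq_path (hA : Integrable (fun x => ‖x‖ ^ 2) A)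
    (hB : Integrable (fun x => ‖x‖ ^ 2) B) {a : ℝ} (ha : 0 < a) :
    Integrable (fun p : E × E => ‖postMean B a (a • p.1 + p.2)‖ ^ 2) (A.prod (stdGaussian E)) := by
  obtain ⟨C, -, hC⟩ := exists_norm_postMean_sq_le hB ha
  refine integrable_prod_of_le_sq hA (by fun_prop) (C := C) fun p => ?_
  rw [abs_of_nonneg (sq_nonneg _)]
  exact hC p.1 p.2

theorem integrable_inner_fst_postMean_path (hA : Integrable (fun x => ‖x‖ ^ 2) A)
    (hB : Integrable (fun x => ‖x‖ ^ 2) B) {a : ℝ} (ha : 0 < a) :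
    Integrable (fun p : E × E => inner ℝ p.1 (postMean B a (a • p.1 + p.2)))
      (A.prod (stdGaussian E)) :=
  integrable_inner_postMean_path hA hB ha measurable_fst (c := 1)
    fun p => by nlinarith [sq_nonneg ‖p.2‖]

/-- The derivative of the expected log-evidence in the signal strength. -/
theorem hasDerivAt_expLogEvidence (hA : Integrable (fun x => ‖x‖ ^ 2) A)
    (hB : Integrable (fun x => ‖x‖ ^ 2) B) {a : ℝ} (ha : 0 < a) :
    HasDerivAt (expLogEvidence A B)
      (a * ∫ p, (2 * inner ℝ p.1 (postMean B a (a • p.1 + p.2)) -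
        ‖postMean B a (a • p.1 + p.2)‖ ^ 2) ∂(A.prod (stdGaussian E))) a := by
  -- The neighbourhood [a/2, 2a] stays away from zero, so that one constant bounds the posterior
  -- second moment throughout.
  obtain ⟨C, hC⟩ := exists_postSq_le hB (half_pos ha) (2 * a)
  have hC0 : 0 ≤ C := by
    simpa using (postSq_nonneg (B := B) a 0).trans (hC a ⟨by linarith, by linarith⟩ 0)
  have hC' : ∀ s ∈ Set.Icc (a / 2) (2 * a), ∀ x n, postSq B s (s • x + n) ≤
      C * (2 + 2 * (2 * a) ^ 2) * (1 + (‖x‖ ^ 2 + ‖n‖ ^ 2)) := fun s hs x n => by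
    refine (hC s hs _).trans ?_
    rw [mul_assoc]
    gcongr
    exact one_add_norm_path_sq_le (by rw [abs_of_pos (by linarith [hs.1])]; exact hs.2) x n
  set C₁ := C * (2 + 2 * (2 * a) ^ 2) with hC₁
  have hC₁0 : 0 ≤ C₁ := by positivity
  have hbound : ∀ s ∈ Set.Icc (a / 2) (2 * a), ∀ p : E × E,
      |inner ℝ (p.2 + (2 * s) • p.1) (postMean B s (s • p.1 + p.2)) -
        s * postSq B s (s • p.1 + p.2)| ≤
      (1 + 2 * (4 * a) ^ 2 + C₁ + 2 * a * C₁ + 1) * (1 + (‖p.1‖ ^ 2 + ‖p.2‖ ^ 2)) := by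
    intro s hs p
    have hs0 : 0 ≤ s := by linarith [hs.1]
    have h1 := hC' s hs p.1 p.2
    have h0 := postSq_nonneg (B := B) s (s • p.1 + p.2)
    have h2 := norm_postMean_sq_le hB s (s • p.1 + p.2)
    have h3 := abs_real_inner_le_norm (p.2 + (2 * s) • p.1) (postMean B s (s • p.1 + p.2))
    have h4 : ‖p.2 + (2 * s) • p.1‖ ^ 2 ≤ 2 * (4 * a) ^ 2 * ‖p.1‖ ^ 2 + 2 * ‖p.2‖ ^ 2 := by
      have h5 : ‖p.2 + (2 * s) • p.1‖ ≤ ‖p.2‖ + 4 * a * ‖p.1‖ := by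
        refine (norm_add_le _ _).trans ?_
        rw [norm_smul, Real.norm_of_nonneg (by positivity)]
        have h12 : 2 * s ≤ 4 * a := by linarith [hs.2]
        gcongr
      have h6 : ‖p.2 + (2 * s) • p.1‖ ^ 2 ≤ (‖p.2‖ + 4 * a * ‖p.1‖) ^ 2 := by gcongr
      nlinarith [sq_nonneg (‖p.2‖ - 4 * a * ‖p.1‖)]
    have h7 : s * postSq B s (s • p.1 + p.2) ≤
        2 * a * (C₁ * (1 + (‖p.1‖ ^ 2 + ‖p.2‖ ^ 2))) := by gcongr; exact hs.2
    have h8 := mul_nonneg hs0 h0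
    refine (abs_sub _ _).trans ?_
    rw [abs_of_nonneg h8]
    have h9 : ‖p.2 + (2 * s) • p.1‖ * ‖postMean B s (s • p.1 + p.2)‖ ≤
        (‖p.2 + (2 * s) • p.1‖ ^ 2 + ‖postMean B s (s • p.1 + p.2)‖ ^ 2) / 2 := by
      nlinarith [sq_nonneg (‖p.2 + (2 * s) • p.1‖ - ‖postMean B s (s • p.1 + p.2)‖)]
    have h10 : 0 ≤ (4 * a) ^ 2 * ‖p.2‖ ^ 2 := by positivity
    have h11 : 0 ≤ C₁ * (1 + (‖p.1‖ ^ 2 + ‖p.2‖ ^ 2)) := by positivity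
    nlinarith [sq_nonneg ‖p.1‖, sq_nonneg ‖p.2‖, sq_nonneg (4 * a), h3, h9, h7]
  have h := hasDerivAt_integral_of_dominated_loc_of_deriv_le (μ := A.prod (stdGaussian E))
    (F := fun (s : ℝ) (p : E × E) => Real.log (evidence B s (s • p.1 + p.2)))
    (F' := fun s p => inner ℝ (p.2 + (2 * s) • p.1) (postMean B s (s • p.1 + p.2)) -
        s * postSq B s (s • p.1 + p.2))
    (x₀ := a) (s := Set.Icc (a / 2) (2 * a))
    (bound := fun p => (1 + 2 * (4 * a) ^ 2 + C₁ + 2 * a * C₁ + 1) *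
      (1 + (‖p.1‖ ^ 2 + ‖p.2‖ ^ 2)))
    (Icc_mem_nhds (by linarith) (by linarith))
    (Filter.Eventually.of_forall fun s => Measurable.aestronglyMeasurable (by fun_prop))
    (integrable_log_evidence hA a)
    (Measurable.aestronglyMeasurable (by fun_prop))
    (ae_of_all _ fun p s hs => hbound s hs p)
    (integrable_prod_sq hA _)
    (ae_of_all _ fun p s _ => hasDerivAt_log_evidence_path hB s p.1 p.2)
  refine h.2.congr_deriv ?_
  have hmem : a ∈ Set.Icc (a / 2) (2 * a) := ⟨by linarith, by linarith⟩
  have hI1 := integrable_inner_fst_postMean_path hA hB ha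
  have hI2 := integrable_inner_postMean_path hA hB ha measurable_snd (c := 1)
    fun p => by nlinarith [sq_nonneg ‖p.1‖]
  have hI3 := integrable_norm_postMean_sq_path hA hB ha
  have hI4 : Integrable (fun p : E × E => postSq B a (a • p.1 + p.2)) (A.prod (stdGaussian E)) := by
    refine integrable_prod_of_le_sq hA (by fun_prop) (C := C₁) fun p => ?_
    rw [abs_of_nonneg (postSq_nonneg _ _)]
    exact hC' a hmem p.1 p.2
  -- The noise term becomes a E[postSq] - a E‖m_B‖²; its first part cancels the second-moment term
  -- of the derivative.
  have hS : ∫ p, inner ℝ p.2 (postMean B a (a • p.1 + p.2)) ∂(A.prod (stdGaussian E)) =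
      a * ∫ p, (postSq B a (a • p.1 + p.2) - ‖postMean B a (a • p.1 + p.2)‖ ^ 2)
        ∂(A.prod (stdGaussian E)) := by
    have hI43 : Integrable (fun p : E × E => postSq B a (a • p.1 + p.2) -
      ‖postMean B a (a • p.1 + p.2)‖ ^ 2) (A.prod (stdGaussian E)) := hI4.sub hI3
    rw [integral_prod _ hI2, integral_prod _ hI43, ← integral_const_mul]
    exact integral_congr_ae (ae_of_all _ fun x =>
      integral_inner_postMean_stdGaussian hB ha (a • x))
  rw [integral_sub hI4 hI3] at hS
  rw [integral_sub (hI1.const_mul 2) hI3, integral_const_mul, integral_sub, integral_const_mul]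
  · simp_rw [inner_add_left, real_inner_smul_left]
    rw [integral_add hI2 (hI1.const_mul _), integral_const_mul, hS]
    ring
  · simp_rw [inner_add_left, real_inner_smul_left]
    exact hI2.add (hI1.const_mul _)
  · exact hI4.const_mul a

/-- The joint law of `X` and `a • X + N`. -/
theorem map_path_prod_stdGaussian (a : ℝ) :
    (A.prod (stdGaussian E)).map (fun p => (p.1, a • p.1 + p.2)) =
      (A.prod (stdGaussian E)).withDensity (fun p => ENNReal.ofReal (tilt a p.2 p.1)) := by
  have hm : Measurable fun p : E × E => ENNReal.ofReal (tilt a p.2 p.1) :=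
    ENNReal.measurable_ofReal.comp (Continuous.measurable (by fun_prop))
  refine Measure.ext_of_lintegral _ fun f hf => ?_
  rw [lintegral_map hf (by fun_prop), lintegral_withDensity_eq_lintegral_mul _ hm hf,
    lintegral_prod _ (by fun_prop), lintegral_prod _ (by fun_prop)]
  refine lintegral_congr fun x => ?_
  rw [lintegral_add_left_stdGaussian (a • x) (f := fun z => f (x, z)) (by fun_prop)]
  refine lintegral_congr fun z => ?_
  simp only [Pi.mul_apply, tilt, real_inner_smul_left, norm_smul, mul_pow, Real.norm_eq_abs, sq_abs,
    real_inner_comm x z]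

theorem integral_path_prod_stdGaussian (a : ℝ) {f : E × E → ℝ} (hf : Measurable f) :
    ∫ p, f (p.1, a • p.1 + p.2) ∂(A.prod (stdGaussian E)) =
      ∫ p, tilt a p.2 p.1 * f p ∂(A.prod (stdGaussian E)) := by
  have hm : Measurable fun p : E × E => ENNReal.ofReal (tilt a p.2 p.1) :=
    ENNReal.measurable_ofReal.comp (Continuous.measurable (by fun_prop))
  rw [← integral_map (φ := fun p : E × E => (p.1, a • p.1 + p.2)) (by fun_prop)
    hf.aestronglyMeasurable, map_path_prod_stdGaussian,
    integral_withDensity_eq_integral_toReal_smul hm (by simp)]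
  refine integral_congr_ae (ae_of_all _ fun z => ?_)
  simp [ENNReal.toReal_ofReal (tilt_pos _ _ _).le]

theorem integrable_path_prod_stdGaussian_iff (a : ℝ) {f : E × E → ℝ} (hf : Measurable f) :
    Integrable (fun p => f (p.1, a • p.1 + p.2)) (A.prod (stdGaussian E)) ↔
      Integrable (fun p => tilt a p.2 p.1 * f p) (A.prod (stdGaussian E)) := by
  have hm : Measurable fun p : E × E => ENNReal.ofReal (tilt a p.2 p.1) :=
    ENNReal.measurable_ofReal.comp (Continuous.measurable (by fun_prop))
  have h1 := integrable_map_measure (μ := A.prod (stdGaussian E))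
    (f := fun p : E × E => (p.1, a • p.1 + p.2)) (g := f) hf.aestronglyMeasurable
    (by fun_prop)
  rw [map_path_prod_stdGaussian, integrable_withDensity_iff_integrable_smul' hm (by simp)] at h1
  rw [show (fun p => f (p.1, a • p.1 + p.2)) = f ∘ fun p : E × E => (p.1, a • p.1 + p.2) from rfl,
    ← h1]
  simp [ENNReal.toReal_ofReal (tilt_pos _ _ _).le]

/-- The law of `a • X + N` has density `evidence A a` relative to the standard Gaussian. -/
theorem integral_comp_path_eq_integral_evidence_mul (a : ℝ) {f : E → ℝ} (hf : Measurable f)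
    (hi : Integrable (fun p : E × E => f (a • p.1 + p.2)) (A.prod (stdGaussian E))) :
    Integrable (fun z => evidence A a z * f z) (stdGaussian E) ∧
    ∫ p, f (a • p.1 + p.2) ∂(A.prod (stdGaussian E)) =
      ∫ z, evidence A a z * f z ∂(stdGaussian E) := by
  have hf' : Measurable fun p : E × E => f p.2 := by fun_prop
  have h1 := (integrable_path_prod_stdGaussian_iff a hf').1 hi
  have h2 := h1.integral_prod_right
  simp_rw [integral_mul_const] at h2
  refine ⟨h2, ?_⟩
  rw [integral_path_prod_stdGaussian a hf', integral_prod_symm _ h1]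
  simp_rw [integral_mul_const]
  rfl

/-- Tower property: under the true law `A`, the signal given the observation z has density
tilt/evidence with respect to `A`. -/
theorem integral_inner_eq_integral_inner_postMean (hA : Integrable (fun x => ‖x‖ ^ 2) A) (a : ℝ)
    {φ : E → E} (hφ : Measurable φ)
    (hi : Integrable (fun p : E × E => inner ℝ p.1 (φ (a • p.1 + p.2))) (A.prod (stdGaussian E)))
    (hi' : Integrable (fun p : E × E => inner ℝ (postMean A a (a • p.1 + p.2)) (φ (a • p.1 + p.2)))
      (A.prod (stdGaussian E))) :
    ∫ p, inner ℝ p.1 (φ (a • p.1 + p.2)) ∂(A.prod (stdGaussian E)) =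
      ∫ p, inner ℝ (postMean A a (a • p.1 + p.2)) (φ (a • p.1 + p.2))
        ∂(A.prod (stdGaussian E)) := by
  have hm : Measurable fun p : E × E => (inner ℝ p.1 (φ p.2) : ℝ) := by fun_prop
  have h1 := (integrable_path_prod_stdGaussian_iff a hm).1 hi
  rw [integral_path_prod_stdGaussian a hm, integral_prod_symm _ h1,
    (integral_comp_path_eq_integral_evidence_mul a
      (f := fun z => inner ℝ (postMean A a z) (φ z)) (by fun_prop) hi').2]
  refine integral_congr_ae (ae_of_all _ fun z => ?_)
  simp only
  rw [real_inner_comm, inner_postMean hA, mul_inv_cancel_left₀ (evidence_pos A a z).ne']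
  simp_rw [real_inner_comm (φ z)]

/-- The divergence between the laws of `a • X + N` for `X ∼ A` and `X ∼ B`. -/
def smoothedKL (A B : Measure E) (a : ℝ) : ℝ := expLogEvidence A A a - expLogEvidence A B a

/-- The tower property replaces the signal by m_A in both derivatives, and 2‖m_A‖² - ‖m_A‖² - 2
m_A·m_B + ‖m_B‖² = ‖m_A - m_B‖². -/
theorem hasDerivAt_smoothedKL (hA : Integrable (fun x => ‖x‖ ^ 2) A)
    (hB : Integrable (fun x => ‖x‖ ^ 2) B) {a : ℝ} (ha : 0 < a) :
    HasDerivAt (smoothedKL A B)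
      (a * ∫ p, ‖postMean A a (a • p.1 + p.2) - postMean B a (a • p.1 + p.2)‖ ^ 2
        ∂(A.prod (stdGaussian E))) a := by
  refine ((hasDerivAt_expLogEvidence hA hA ha).sub
    (hasDerivAt_expLogEvidence hA hB ha)).congr_deriv ?_
  rw [← mul_sub]
  congr 1
  have hA1 := integrable_inner_fst_postMean_path hA hA ha
  have hB1 := integrable_inner_fst_postMean_path hA hB ha
  have hA2 := integrable_norm_postMean_sq_path hA hA ha
  have hB2 := integrable_norm_postMean_sq_path hA hB ha
  obtain ⟨C, -, hC⟩ := exists_norm_postMean_sq_le hA ha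
  have hAB := integrable_inner_postMean_path hA hB ha
    (f := fun p => postMean A a (a • p.1 + p.2)) (by fun_prop) (fun p => hC p.1 p.2)
  have hAA := integrable_inner_postMean_path hA hA ha
    (f := fun p => postMean A a (a • p.1 + p.2)) (by fun_prop) (fun p => hC p.1 p.2)
  rw [integral_sub (hA1.const_mul 2) hA2, integral_sub (hB1.const_mul 2) hB2, integral_const_mul,
    integral_const_mul,
    integral_inner_eq_integral_inner_postMean hA a (φ := postMean A a) (by fun_prop) hA1 hAA,
    integral_inner_eq_integral_inner_postMean hA a (φ := postMean B a) (by fun_prop) hB1 hAB]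
  simp_rw [norm_sub_sq_real, real_inner_self_eq_norm_sq]
  rw [integral_add (hA2.sub' (hAB.const_mul 2)) hB2, integral_sub hA2 (hAB.const_mul 2),
    integral_const_mul]
  ring

theorem smoothedKL_zero : smoothedKL A B 0 = 0 := by simp [smoothedKL, expLogEvidence_zero]

theorem continuousAt_smoothedKL (hA : Integrable (fun x => ‖x‖ ^ 2) A)
    (hB : Integrable (fun x => ‖x‖ ^ 2) B) (a : ℝ) : ContinuousAt (smoothedKL A B) a :=
  (continuousAt_expLogEvidence hA hA a).sub (continuousAt_expLogEvidence hA hB a)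

end Channel

/-! ### Variational formula and recovery of the divergence from its smoothings -/

section Variational

/-- Young's inequality for r log r - r and its convex conjugate exp, from 1 + s ≤ exp s at s = g -
log r. -/
theorem mul_le_mul_log_sub_add_exp {r : ℝ} (hr : 0 ≤ r) (g : ℝ) :
    r * g ≤ r * Real.log r - r + Real.exp g := by
  rcases hr.eq_or_lt with rfl | hr
  · simpa using (Real.exp_pos g).le
  · have h1 := Real.add_one_le_exp (g - Real.log r)
    rw [Real.exp_sub, Real.exp_log hr, le_div_iff₀ hr] at h1
    linarith

/-- The variational lower bound for the Kullback–Leibler divergence. -/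
theorem ofReal_integral_sub_integral_exp_le_klDiv {S : Type*} [MeasurableSpace S]
    {μ ν : Measure S} [IsProbabilityMeasure μ] [IsProbabilityMeasure ν] {g : S → ℝ}
    (hg : Integrable g μ) (hexp : Integrable (fun x => Real.exp (g x)) ν) :
    ENNReal.ofReal (∫ x, g x ∂μ - ∫ x, Real.exp (g x) ∂ν + 1) ≤ klDiv μ ν := by
  by_cases htop : klDiv μ ν = ⊤
  · simp [htop]
  obtain ⟨hac, hllr⟩ := klDiv_ne_top_iff.1 htop
  refine ENNReal.ofReal_le_of_le_toReal ?_
  have hk := (integrable_klFun_rnDeriv_iff hac).2 hllr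
  have hrg : Integrable (fun x => (μ.rnDeriv ν x).toReal * g x) ν :=
    (integrable_rnDeriv_smul_iff hac).2 hg
  rw [toReal_klDiv_eq_integral_klFun hac, ← integral_rnDeriv_smul hac]
  simp only [smul_eq_mul]
  have h := integral_mono (hrg.sub' hexp) (hk.sub' (integrable_const 1)) fun x => by
    have := mul_le_mul_log_sub_add_exp (r := (μ.rnDeriv ν x).toReal) ENNReal.toReal_nonneg (g x)
    simp only [klFun]
    linarith
  rw [integral_sub hrg hexp, integral_sub hk (integrable_const 1)] at h
  simp at h
  linarith

variable {E : Type*} [NormedAddCommGroup E] [InnerProductSpace ℝ E] [FiniteDimensional ℝ E]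
  [MeasurableSpace E] [BorelSpace E]
variable {A B : Measure E} [IsProbabilityMeasure A] [IsProbabilityMeasure B]

theorem integrable_of_abs_le {S : Type*} [MeasurableSpace S] {μ : Measure S} [IsFiniteMeasure μ]
    {f : S → ℝ} (hf : Measurable f) {c : ℝ} (h : ∀ x, |f x| ≤ c) : Integrable f μ :=
  (integrable_const c).mono' hf.aestronglyMeasurable (ae_of_all _ h)

theorem integrable_exp_of_abs_le {S : Type*} [MeasurableSpace S] {μ : Measure S}
    [IsFiniteMeasure μ] {f : S → ℝ} (hf : Measurable f) {c : ℝ} (h : ∀ x, |f x| ≤ c) :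
    Integrable (fun x => Real.exp (f x)) μ :=
  integrable_of_abs_le (c := Real.exp c) (by fun_prop) fun x => by
    rw [Real.abs_exp]
    exact Real.exp_le_exp.2 ((le_abs_self _).trans (h x))

/-- A variational bound for continuous bounded test functions extends to measurable ones. -/
theorem variational_bound_of_continuous {L : ℝ}
    (h : ∀ (f : E → ℝ) (c : ℝ), Continuous f → (∀ x, |f x| ≤ c) →
      ∫ x, f x ∂A - ∫ x, Real.exp (f x) ∂B + 1 ≤ L)
    {f : E → ℝ} (hf : Measurable f) {c : ℝ} (hc : ∀ x, |f x| ≤ c) :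
    ∫ x, f x ∂A - ∫ x, Real.exp (f x) ∂B + 1 ≤ L := by
  have hc0 : 0 ≤ c := (abs_nonneg _).trans (hc 0)
  have hmain : ∀ ε : ℝ, 0 < ε →
      ∫ x, f x ∂A - ∫ x, Real.exp (f x) ∂B + 1 ≤ L + (1 + Real.exp c) * ε := by
    intro ε hε
    -- Approximation in L¹(A + B), followed by clipping to [-c, c]. Clipping does not increase the
    -- distance to `f`, and exp is Lipschitz with constant exp c on that interval.
    obtain ⟨g, hg, -⟩ := (integrable_of_abs_le (μ := A + B) hf
      hc).exists_boundedContinuous_integral_sub_le hε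
    set g' : E → ℝ := fun x => max (-c) (min (g x) c) with hg'
    have hg'c : Continuous g' := by
      have := g.continuous
      fun_prop
    have hg'b : ∀ x, |g' x| ≤ c := fun x => abs_le.2
      ⟨le_max_left _ _, max_le (by linarith) (min_le_right _ _)⟩
    have hclip : ∀ x, |f x - g' x| ≤ ‖f x - g x‖ := fun x => by
      have h1 := abs_le.1 (hc x)
      rw [Real.norm_eq_abs]
      have h2 := le_abs_self (f x - g x)
      have h3 := neg_abs_le (f x - g x)
      have h4 := abs_nonneg (f x - g x)
      simp only [hg', max_def, min_def]
      rw [abs_le]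
      constructor <;> split_ifs <;> linarith
    have hdi : ∀ μ : Measure E, IsFiniteMeasure μ → Integrable (fun x => |f x - g' x|) μ :=
      fun μ _ => ((integrable_of_abs_le hf hc).sub
        (integrable_of_abs_le hg'c.measurable hg'b)).abs
    have hAB : ∫ x, |f x - g' x| ∂A + ∫ x, |f x - g' x| ∂B ≤ ε := by
      rw [← integral_add_measure (hdi A inferInstance) (hdi B inferInstance)]
      refine (integral_mono (hdi _ inferInstance) ?_ hclip).trans hg
      exact ((integrable_of_abs_le hf hc).sub
        (integrable_of_abs_le g.continuous.measurable g.norm_coe_le_norm)).norm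
    have hA0 : 0 ≤ ∫ x, |f x - g' x| ∂A := integral_nonneg fun x => abs_nonneg _
    have hB0 : 0 ≤ ∫ x, |f x - g' x| ∂B := integral_nonneg fun x => abs_nonneg _
    have h1 : ∫ x, f x ∂A ≤ ∫ x, g' x ∂A + ∫ x, |f x - g' x| ∂A := by
      rw [← integral_add (integrable_of_abs_le hg'c.measurable hg'b) (hdi A inferInstance)]
      refine integral_mono (integrable_of_abs_le hf hc)
        ((integrable_of_abs_le hg'c.measurable hg'b).add (hdi A inferInstance)) fun x => ?_
      simp only
      linarith [le_abs_self (f x - g' x)]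
    have h2 : ∫ x, Real.exp (g' x) ∂B ≤
        ∫ x, Real.exp (f x) ∂B + Real.exp c * ∫ x, |f x - g' x| ∂B := by
      rw [← integral_const_mul, ← integral_add (integrable_exp_of_abs_le hf hc)
        ((hdi B inferInstance).const_mul _)]
      refine integral_mono (integrable_exp_of_abs_le hg'c.measurable hg'b)
        ((integrable_exp_of_abs_le hf hc).add ((hdi B inferInstance).const_mul _)) fun x => ?_
      simp only
      have h3 := Real.add_one_le_exp (f x - g' x)
      rw [Real.exp_sub, le_div_iff₀ (Real.exp_pos _)] at h3
      have h4 : Real.exp (g' x) ≤ Real.exp c :=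
        Real.exp_le_exp.2 ((le_abs_self _).trans (hg'b x))
      have h5 := neg_abs_le (f x - g' x)
      have h6 := mul_le_mul_of_nonneg_right h4 (abs_nonneg (f x - g' x))
      nlinarith [Real.exp_pos (g' x)]
    have h3 := h g' c hg'c hg'b
    have h4 : Real.exp c * ∫ x, |f x - g' x| ∂B ≤ Real.exp c * ε := by
      gcongr; linarith
    linarith
  refine le_of_forall_pos_le_add fun δ hδ => ?_
  have hpos : 0 < 1 + Real.exp c := by positivity
  have := hmain (δ / (1 + Real.exp c)) (by positivity)
  rwa [mul_div_cancel₀ _ hpos.ne'] at this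

/-- The Kullback–Leibler divergence is the supremum of its variational lower bounds over bounded
continuous test functions. -/
theorem klDiv_le_ofReal_of_variational_bound {L : ℝ}
    (h : ∀ (f : E → ℝ) (c : ℝ), Continuous f → (∀ x, |f x| ≤ c) →
      ∫ x, f x ∂A - ∫ x, Real.exp (f x) ∂B + 1 ≤ L) :
    klDiv A B ≤ ENNReal.ofReal L := by
  have hmeas : ∀ (f : E → ℝ) (c : ℝ), Measurable f → (∀ x, |f x| ≤ c) →
      ∫ x, f x ∂A - ∫ x, Real.exp (f x) ∂B + 1 ≤ L :=
    fun f c hf hc => variational_bound_of_continuous h hf hc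
  -- On a `B`-null set s the test function n·1_s gives n A(s) ≤ L for every n.
  have hac : A ≪ B := by
    refine Measure.AbsolutelyContinuous.mk fun s hs hBs => ?_
    have h1 : ∀ n : ℕ, (n : ℝ) * A.real s ≤ L := fun n => by
      have h2 := hmeas (s.indicator fun _ => (n : ℝ)) n (measurable_const.indicator hs) fun x => by
        by_cases hx : x ∈ s <;> simp [hx]
      have h3 : ∫ x, Real.exp (s.indicator (fun _ => (n : ℝ)) x) ∂B = 1 := by
        have h4 : (fun x => Real.exp (s.indicator (fun _ => (n : ℝ)) x)) =ᵐ[B] fun _ => 1 := by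
          have h5 : ∀ᵐ x ∂B, x ∉ s := measure_eq_zero_iff_ae_notMem.1 hBs
          filter_upwards [h5] with x hx
          simp [hx]
        rw [integral_congr_ae h4]
        simp
      rw [h3, integral_indicator hs, setIntegral_const, smul_eq_mul] at h2
      linarith
    by_contra hne
    have hpos : 0 < A.real s := ENNReal.toReal_pos hne (measure_ne_top _ _)
    obtain ⟨n, hn⟩ := exists_nat_gt (L / A.real s)
    rw [div_lt_iff₀ hpos] at hn
    linarith [h1 n]
  set r : E → ℝ := fun x => (A.rnDeriv B x).toReal with hr
  have hrm : Measurable r := by fun_prop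
  have hr0 : ∀ x, 0 ≤ r x := fun x => ENNReal.toReal_nonneg
  -- The optimal test function is log r; truncating the density to [1/(n+1), n+1] makes it bounded.
  set c : ℕ → E → ℝ := fun n x => max ((n + 1 : ℝ)⁻¹) (min (r x) (n + 1)) with hcdef
  have hcm : ∀ n, Measurable (c n) := fun n => by fun_prop
  have hNpos : ∀ n : ℕ, (0 : ℝ) < n + 1 := fun n => by positivity
  have hNinv : ∀ n : ℕ, ((n : ℝ) + 1)⁻¹ ≤ 1 := fun n =>
    inv_le_one_of_one_le₀ (by linarith [(Nat.cast_nonneg n : (0 : ℝ) ≤ n)])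
  have hcpos : ∀ n x, 0 < c n x := fun n x =>
    lt_of_lt_of_le (inv_pos.2 (hNpos n)) (le_max_left _ _)
  have hcle : ∀ n x, c n x ≤ n + 1 := fun n x =>
    max_le ((hNinv n).trans (by linarith [(Nat.cast_nonneg n : (0 : ℝ) ≤ n)])) (min_le_right _ _)
  have hlogb : ∀ n x, |Real.log (c n x)| ≤ Real.log (n + 1) := fun n x => by
    rw [abs_le]
    constructor
    · rw [← Real.log_inv]
      exact Real.log_le_log (inv_pos.2 (hNpos n)) (le_max_left _ _)
    · exact Real.log_le_log (hcpos n x) (hcle n x)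
  -- The expression equals klFun(c) + (r - c) log c. Truncation moves r towards 1, so r - c and log
  -- c never have opposite signs. Nonnegativity lets the bound pass to the limit by Fatou's lemma.
  have hnonneg : ∀ n x, 0 ≤ r x * Real.log (c n x) - c n x + 1 := fun n x => by
    have h1 := klFun_nonneg (hcpos n x).le
    rw [klFun_apply] at h1
    have h2 : 0 ≤ (r x - c n x) * Real.log (c n x) := by
      rcases le_total (r x) 1 with hx | hx
      · have h3 : r x ≤ c n x := by
          refine le_trans ?_ (le_max_right _ _)
          exact le_min le_rfl (hx.trans (by linarith [(Nat.cast_nonneg n : (0 : ℝ) ≤ n)]))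
        have h4 : c n x ≤ 1 := max_le (hNinv n) ((min_le_left _ _).trans hx)
        exact mul_nonneg_of_nonpos_of_nonpos (by linarith)
          (Real.log_nonpos (hcpos n x).le h4)
      · have h3 : c n x ≤ r x := max_le ((hNinv n).trans hx) (min_le_left _ _)
        have h4 : 1 ≤ c n x := le_trans (le_min hx (by linarith [(Nat.cast_nonneg n : (0 : ℝ) ≤ n)]))
          (le_max_right _ _)
        exact mul_nonneg (by linarith) (Real.log_nonneg h4)
    linarith
  have hlim : ∀ x, Filter.Tendsto (fun n => r x * Real.log (c n x) - c n x + 1) Filter.atTop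
      (nhds (klFun (r x))) := fun x => by
    have h1 : Filter.Tendsto (fun n => c n x) Filter.atTop (nhds (r x)) := by
      have h2 : Filter.Tendsto (fun n : ℕ => ((n : ℝ) + 1)⁻¹) Filter.atTop (nhds 0) :=
        tendsto_inv_atTop_zero.comp
          (Filter.tendsto_atTop_add_const_right _ _ tendsto_natCast_atTop_atTop)
      have h3 : Filter.Tendsto (fun n : ℕ => min (r x) ((n : ℝ) + 1)) Filter.atTop
          (nhds (r x)) := by
        refine tendsto_const_nhds.congr' ?_
        obtain ⟨N, hN⟩ := exists_nat_ge (r x)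
        filter_upwards [Filter.eventually_ge_atTop N] with n hn
        rw [min_eq_left]
        have : (N : ℝ) ≤ n := by exact_mod_cast hn
        linarith
      simpa [max_eq_right (hr0 x)] using h2.max h3
    have h2 : Filter.Tendsto (fun n => r x * Real.log (c n x)) Filter.atTop
        (nhds (r x * Real.log (r x))) := by
      rcases (hr0 x).eq_or_lt with h0 | h0
      · simp [← h0]
      · exact (h1.log h0.ne').const_mul _
    have h3 := (h2.sub h1).add_const 1
    convert h3 using 2
    rw [klFun_apply]; ring
  have hrc : ∀ n, Integrable (fun x => r x * Real.log (c n x)) B := fun n =>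
    (integrable_rnDeriv_smul_iff hac).2
      (integrable_of_abs_le (Real.measurable_log.comp (hcm n)) (hlogb n))
  have hci : ∀ n, Integrable (c n) B := fun n =>
    integrable_of_abs_le (c := n + 1) (hcm n)
      fun x => by rw [abs_of_pos (hcpos n x)]; exact hcle n x
  have hbound : ∀ n, ∫⁻ x, ENNReal.ofReal (r x * Real.log (c n x) - c n x + 1) ∂B ≤
      ENNReal.ofReal L := fun n => by
    have hi : Integrable (fun x => r x * Real.log (c n x) - c n x + 1) B :=
      ((hrc n).sub (hci n)).add (integrable_const 1)
    rw [← ofReal_integral_eq_lintegral_ofReal hi (ae_of_all _ (hnonneg n))]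
    refine ENNReal.ofReal_le_ofReal ?_
    have h1 := hmeas (fun x => Real.log (c n x)) (Real.log (n + 1))
      (Real.measurable_log.comp (hcm n)) (hlogb n)
    simp_rw [Real.exp_log (hcpos n _)] at h1
    rw [← integral_rnDeriv_smul hac] at h1
    simp only [smul_eq_mul] at h1
    rw [integral_add ((hrc n).sub' (hci n)) (integrable_const 1), integral_sub (hrc n) (hci n)]
    simpa using h1
  rw [klDiv_eq_lintegral_klFun_of_ac hac]
  calc ∫⁻ x, ENNReal.ofReal (klFun (r x)) ∂B
      = ∫⁻ x, Filter.liminf (fun n => ENNReal.ofReal (r x * Real.log (c n x) - c n x + 1))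
          Filter.atTop ∂B :=
        lintegral_congr fun x =>
          ((ENNReal.continuous_ofReal.tendsto _).comp (hlim x)).liminf_eq.symm
    _ ≤ Filter.liminf (fun n => ∫⁻ x, ENNReal.ofReal (r x * Real.log (c n x) - c n x + 1) ∂B)
          Filter.atTop := lintegral_liminf_le fun n => by
            have := hcm n
            fun_prop
    _ ≤ ENNReal.ofReal L :=
        Filter.liminf_le_of_le (by isBoundedDefault) fun b hb => by
          obtain ⟨n, hn⟩ := hb.exists
          exact hn.trans (hbound n)

theorem map_path_eq_withDensity_evidence (a : ℝ) :
    (A.prod (stdGaussian E)).map (fun p => a • p.1 + p.2) =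
      (stdGaussian E).withDensity (fun z => ENNReal.ofReal (evidence A a z)) := by
  have hm : Measurable fun p : E × E => ENNReal.ofReal (tilt a p.2 p.1) :=
    ENNReal.measurable_ofReal.comp (Continuous.measurable (by fun_prop))
  have h1 : (A.prod (stdGaussian E)).map (fun p => a • p.1 + p.2) =
      ((A.prod (stdGaussian E)).map (fun p => (p.1, a • p.1 + p.2))).map Prod.snd := by
    rw [Measure.map_map measurable_snd (by fun_prop)]
    rfl
  rw [h1, map_path_prod_stdGaussian]
  refine Measure.ext_of_lintegral _ fun f hf => ?_
  rw [lintegral_map hf measurable_snd, lintegral_withDensity_eq_lintegral_mul _ hm (by fun_prop),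
    lintegral_withDensity_eq_lintegral_mul _ (by fun_prop) hf, lintegral_prod_symm _ (by fun_prop)]
  refine lintegral_congr fun z => ?_
  simp only [Pi.mul_apply]
  rw [lintegral_mul_const _ (by fun_prop), evidence,
    ofReal_integral_eq_lintegral_ofReal (integrable_tilt A a z)
      (ae_of_all _ fun x => (tilt_pos a z x).le)]

theorem integrable_evidence (a : ℝ) : Integrable (evidence A a) (stdGaussian E) := by
  simpa using (integral_comp_path_eq_integral_evidence_mul (A := A) a (f := fun _ => 1)
    measurable_const (integrable_const _)).1

theorem integral_evidence (a : ℝ) : ∫ z, evidence A a z ∂(stdGaussian E) = 1 := by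
  simpa using (integral_comp_path_eq_integral_evidence_mul (A := A) a (f := fun _ => 1)
    measurable_const (integrable_const _)).2.symm

theorem integral_log_evidence_ratio (hA : Integrable (fun x => ‖x‖ ^ 2) A) (a : ℝ) :
    Integrable (fun p : E × E => Real.log (evidence A a (a • p.1 + p.2)) -
      Real.log (evidence B a (a • p.1 + p.2))) (A.prod (stdGaussian E)) ∧
    ∫ p, (Real.log (evidence A a (a • p.1 + p.2)) - Real.log (evidence B a (a • p.1 + p.2)))
      ∂(A.prod (stdGaussian E)) = smoothedKL A B a :=
  ⟨(integrable_log_evidence hA a).sub (integrable_log_evidence hA a),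
    integral_sub (integrable_log_evidence hA a) (integrable_log_evidence hA a)⟩

/-- Data processing, followed by the variational bound with the log-ratio of evidences as test
function, whose exponential has integral one. -/
theorem ofReal_smoothedKL_le_klDiv (hA : Integrable (fun x => ‖x‖ ^ 2) A) (a : ℝ) :
    ENNReal.ofReal (smoothedKL A B a) ≤ klDiv A B := by
  have hT : Measurable fun p : E × E => a • p.1 + p.2 := by fun_prop
  have h1 : klDiv ((A.prod (stdGaussian E)).map fun p => a • p.1 + p.2)
      ((B.prod (stdGaussian E)).map fun p => a • p.1 + p.2) ≤ klDiv A B := by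
    refine (klDiv_map_le _ _ hT).trans ?_
    -- The noise is a constant kernel common to both laws, so adjoining it leaves the divergence
    -- unchanged.
    rw [← Measure.compProd_const, ← Measure.compProd_const, klDiv_compProd_left]
  refine le_trans ?_ h1
  have : IsProbabilityMeasure ((A.prod (stdGaussian E)).map fun p => a • p.1 + p.2) :=
    Measure.isProbabilityMeasure_map hT.aemeasurable
  have : IsProbabilityMeasure ((B.prod (stdGaussian E)).map fun p => a • p.1 + p.2) :=
    Measure.isProbabilityMeasure_map hT.aemeasurable
  have hgm : Measurable fun z : E => Real.log (evidence A a z) - Real.log (evidence B a z) := by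
    fun_prop
  have hexp : ∀ z, Real.exp (Real.log (evidence A a z) - Real.log (evidence B a z)) =
      evidence A a z / evidence B a z := fun z => by
    rw [Real.exp_sub, Real.exp_log (evidence_pos A a z), Real.exp_log (evidence_pos B a z)]
  have hexp' : ∀ z, (ENNReal.ofReal (evidence B a z)).toReal •
      Real.exp (Real.log (evidence A a z) - Real.log (evidence B a z)) = evidence A a z := fun z => by
    rw [hexp, ENNReal.toReal_ofReal (evidence_pos B a z).le, smul_eq_mul,
      mul_div_cancel₀ _ (evidence_pos B a z).ne']
  have h2 := ofReal_integral_sub_integral_exp_le_klDiv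
    (μ := (A.prod (stdGaussian E)).map fun p => a • p.1 + p.2)
    (ν := (B.prod (stdGaussian E)).map fun p => a • p.1 + p.2)
    (g := fun z => Real.log (evidence A a z) - Real.log (evidence B a z))
    ((integrable_map_measure hgm.aestronglyMeasurable hT.aemeasurable).2
      (integral_log_evidence_ratio hA a).1)
    (by
      rw [map_path_eq_withDensity_evidence, integrable_withDensity_iff_integrable_smul'
        (by fun_prop) (by simp)]
      simp_rw [hexp']
      exact integrable_evidence a)
  have h3 : ∫ z, Real.exp (Real.log (evidence A a z) - Real.log (evidence B a z))
      ∂((B.prod (stdGaussian E)).map fun p => a • p.1 + p.2) = 1 := by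
    rw [map_path_eq_withDensity_evidence,
      integral_withDensity_eq_integral_toReal_smul (by fun_prop) (by simp)]
    simp_rw [hexp']
    exact integral_evidence a
  rw [integral_map hT.aemeasurable hgm.aestronglyMeasurable,
    (integral_log_evidence_ratio hA a).2, h3, sub_add_cancel] at h2
  exact h2

/-- Young's inequality with r the ratio of evidences, integrated against the evidence of `B`. -/
theorem integral_comp_path_sub_le_smoothedKL (hA : Integrable (fun x => ‖x‖ ^ 2) A) (a : ℝ)
    {f : E → ℝ} (hf : Measurable f) {c : ℝ} (hc : ∀ x, |f x| ≤ c) :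
    ∫ p, f (a • p.1 + p.2) ∂(A.prod (stdGaussian E)) -
      ∫ p, Real.exp (f (a • p.1 + p.2)) ∂(B.prod (stdGaussian E)) + 1 ≤ smoothedKL A B a := by
  obtain ⟨i1, e1⟩ := integral_comp_path_eq_integral_evidence_mul (A := A) a hf
    (integrable_of_abs_le (by fun_prop) fun p => hc _)
  obtain ⟨i2, e2⟩ := integral_comp_path_eq_integral_evidence_mul (A := B) a
    (f := fun z => Real.exp (f z)) (by fun_prop)
    (integrable_exp_of_abs_le (f := fun p : E × E => f (a • p.1 + p.2)) (by fun_prop)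
      fun p => hc _)
  obtain ⟨i3, e3⟩ := integral_comp_path_eq_integral_evidence_mul (A := A) a
    (f := fun z => Real.log (evidence A a z) - Real.log (evidence B a z)) (by fun_prop)
    (integral_log_evidence_ratio hA a).1
  rw [← (integral_log_evidence_ratio hA a).2, e1, e2, e3]
  have h := integral_mono (i1.sub' i2) (i3.sub' (integrable_evidence (A := A) a)) fun z => by
    have hA0 := evidence_pos A a z
    have hB0 := evidence_pos B a z
    have h1 := mul_le_mul_log_sub_add_exp (div_pos hA0 hB0).le (f z)
    rw [Real.log_div hA0.ne' hB0.ne'] at h1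
    have h2 := mul_le_mul_of_nonneg_left h1 hB0.le
    simp only
    have h3 : evidence B a z * (evidence A a z / evidence B a z) = evidence A a z :=
      mul_div_cancel₀ _ hB0.ne'
    rw [mul_add, mul_sub, ← mul_assoc, ← mul_assoc, h3] at h2
    linarith
  rw [integral_sub i1 i2, integral_sub i3 (integrable_evidence a), integral_evidence] at h
  linarith

theorem tendsto_integral_comp_add_inv_smul {f : E → ℝ} (hf : Continuous f) {c : ℝ}
    (hc : ∀ x, |f x| ≤ c) :
    Filter.Tendsto (fun n : ℕ => ∫ p, f (p.1 + ((n : ℝ) + 1)⁻¹ • p.2) ∂(A.prod (stdGaussian E)))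
      Filter.atTop (nhds (∫ x, f x ∂A)) := by
  have h0 : ∫ x, f x ∂A = ∫ p, f p.1 ∂(A.prod (stdGaussian E)) := by
    have hi : Integrable (fun p : E × E => f p.1) (A.prod (stdGaussian E)) :=
      integrable_of_abs_le (hf.measurable.comp measurable_fst) fun p => hc _
    rw [integral_prod _ hi]
    simp
  rw [h0]
  refine tendsto_integral_of_dominated_convergence (fun _ => c)
    (fun n => Continuous.aestronglyMeasurable (by fun_prop)) (integrable_const c)
    (fun n => ae_of_all _ fun p => hc _) (ae_of_all _ fun p => ?_)
  have h2 : Filter.Tendsto (fun n : ℕ => ((n : ℝ) + 1)⁻¹) Filter.atTop (nhds 0) :=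
    tendsto_inv_atTop_zero.comp
      (Filter.tendsto_atTop_add_const_right _ _ tendsto_natCast_atTop_atTop)
  have h3 : Filter.Tendsto (fun n : ℕ => p.1 + ((n : ℝ) + 1)⁻¹ • p.2) Filter.atTop
      (nhds p.1) := by
    simpa using (h2.smul_const p.2).const_add p.1
  exact (hf.tendsto p.1).comp h3

/-- At strength n + 1 the test function z ↦ f(z/(n+1)) sees x + N/(n+1), which tends to x. Hence a
bound on all smoothed divergences bounds the variational functional of `A` and `B` themselves. -/
theorem klDiv_le_of_smoothedKL_le (hA : Integrable (fun x => ‖x‖ ^ 2) A) {L : ℝ}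
    (hL : ∀ a : ℝ, 0 < a → smoothedKL A B a ≤ L) : klDiv A B ≤ ENNReal.ofReal L := by
  refine klDiv_le_ofReal_of_variational_bound fun f c hf hc => ?_
  have hlim := ((tendsto_integral_comp_add_inv_smul (A := A) hf hc).sub
    (tendsto_integral_comp_add_inv_smul (A := B) (f := fun x => Real.exp (f x)) (by fun_prop)
      (c := Real.exp c) fun x => by
        rw [Real.abs_exp]; exact Real.exp_le_exp.2 ((le_abs_self _).trans (hc x)))).add_const 1
  refine le_of_tendsto hlim (Filter.Eventually.of_forall fun n => ?_)
  have hn : (0 : ℝ) < n + 1 := by positivity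
  have h := integral_comp_path_sub_le_smoothedKL (B := B) hA ((n : ℝ) + 1)
    (f := fun z => f (((n : ℝ) + 1)⁻¹ • z)) (by fun_prop) (fun x => hc _)
  simp only [smul_add, smul_smul, inv_mul_cancel₀ hn.ne', one_smul] at h
  exact h.trans (hL _ hn)

end Variational

/-! ### From signal strength to flow time -/

section Velocity

variable {d : ℕ} {A B : Measure (EuclideanSpace ℝ (Fin d))} [IsProbabilityMeasure A]
  [IsProbabilityMeasure B]

/-- In the coordinate z = x/(1 - t) the path is the Gaussian channel of strength t/(1 - t). The
prefactor of the tilt does not involve x₁ and cancels in the velocity. -/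
theorem condPathDensity_eq {t : ℝ} (ht : t < 1) (x₁ z : EuclideanSpace ℝ (Fin d)) :
    condPathDensity t x₁ ((1 - t) • z) =
      ((√(2 * Real.pi) * (1 - t)) ^ d)⁻¹ * Real.exp (-‖z‖ ^ 2 / 2) * tilt (t / (1 - t)) z x₁ := by
  have hs : 0 < 1 - t := by linarith
  rw [condPathDensity, tilt_eq, mul_assoc, ← Real.exp_add]
  have h1 : (1 - t) • z - t • x₁ = (1 - t) • (z - (t / (1 - t)) • x₁) := by
    rw [smul_sub, smul_smul, mul_div_cancel₀ _ hs.ne']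
  congr 2
  rw [h1, norm_smul, mul_pow, Real.norm_eq_abs, sq_abs]
  field_simp
  ring

theorem pathDensity_eq {t : ℝ} (ht : t < 1) (z : EuclideanSpace ℝ (Fin d)) :
    pathDensity A t ((1 - t) • z) =
      ((√(2 * Real.pi) * (1 - t)) ^ d)⁻¹ * Real.exp (-‖z‖ ^ 2 / 2) *
        evidence A (t / (1 - t)) z := by
  simp_rw [pathDensity, condPathDensity_eq ht, integral_const_mul, evidence]

theorem velocity_eq (hA : Integrable (fun x => ‖x‖ ^ 2) A) {t : ℝ} (ht : t < 1)
    (z : EuclideanSpace ℝ (Fin d)) :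
    velocity A t ((1 - t) • z) = (1 - t)⁻¹ • (postMean A (t / (1 - t)) z - (1 - t) • z) := by
  have hs : 0 < 1 - t := by linarith
  set a := t / (1 - t) with ha
  have hR := evidence_pos A a z
  have hc : (0 : ℝ) < ((√(2 * Real.pi) * (1 - t)) ^ d)⁻¹ * Real.exp (-‖z‖ ^ 2 / 2) := by positivity
  have h1 : ∀ x₁, (condPathDensity t x₁ ((1 - t) • z) / pathDensity A t ((1 - t) • z)) •
      condVelocity t x₁ ((1 - t) • z) =
      ((1 - t)⁻¹ * (evidence A a z)⁻¹) • (tilt a z x₁ • x₁ - tilt a z x₁ • (1 - t) • z) := by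
    intro x₁
    rw [condPathDensity_eq ht, pathDensity_eq ht, mul_div_mul_left _ _ hc.ne', condVelocity,
      ← ha, ← smul_sub, smul_smul, smul_smul]
    congr 1
    field_simp
  rw [velocity]
  simp_rw [h1]
  rw [integral_smul, integral_sub (integrable_tilt_smul a z (integrable_of_integrable_sq hA))
    ((integrable_tilt A a z).smul_const _), integral_smul_const, mul_smul, smul_sub, ← postMean,
    ← evidence, smul_smul (evidence A a z)⁻¹, inv_mul_cancel₀ hR.ne', one_smul]

theorem measurable_velocity (hA : Integrable (fun x => ‖x‖ ^ 2) A) {t : ℝ} (ht : t < 1) :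
    Measurable (velocity A t) := by
  have hs : 1 - t ≠ 0 := by linarith
  have h1 : velocity A t = fun x => (1 - t)⁻¹ •
      (postMean A (t / (1 - t)) ((1 - t)⁻¹ • x) - (1 - t) • (1 - t)⁻¹ • x) := by
    funext x
    rw [← velocity_eq hA ht, smul_inv_smul₀ hs]
  rw [h1]
  fun_prop

theorem integral_probPath {t : ℝ} (ht : t < 1) {f : EuclideanSpace ℝ (Fin d) → ℝ}
    (hf : Measurable f) :
    ∫ x, f x ∂(probPath A t) = ∫ p, f ((1 - t) • ((t / (1 - t)) • p.1 + p.2))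
      ∂(A.prod (stdGaussian (EuclideanSpace ℝ (Fin d)))) := by
  have hs : 1 - t ≠ 0 := by linarith
  have hm : Measurable fun z : EuclideanSpace ℝ (Fin d) × EuclideanSpace ℝ (Fin d) =>
      linearFlow t z.1 z.2 := by
    unfold linearFlow; fun_prop
  rw [probPath, integral_map hm.aemeasurable hf.aestronglyMeasurable]
  simp only [linearFlow, smul_add, smul_smul, mul_div_cancel₀ _ hs]

/-- `E_{X_t ∼ p_t^A} [t / (1 - t) * ‖u_t^A(X_t) - u_t^B(X_t)‖²]` for the probability paths with
target laws `A` and `B`. -/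
def velocitySqGap (A B : Measure (EuclideanSpace ℝ (Fin d))) (t : ℝ) : ℝ :=
  t / (1 - t) * ∫ x, ‖velocity A t x - velocity B t x‖ ^ 2 ∂(probPath A t)

theorem velocity_sub_velocity (hA : Integrable (fun x => ‖x‖ ^ 2) A)
    (hB : Integrable (fun x => ‖x‖ ^ 2) B) {t : ℝ} (ht : t < 1) (z : EuclideanSpace ℝ (Fin d)) :
    velocity A t ((1 - t) • z) - velocity B t ((1 - t) • z) =
      (1 - t)⁻¹ • (postMean A (t / (1 - t)) z - postMean B (t / (1 - t)) z) := by
  rw [velocity_eq hA ht, velocity_eq hB ht, ← smul_sub, sub_sub_sub_cancel_right]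

theorem velocitySqGap_eq (hA : Integrable (fun x => ‖x‖ ^ 2) A)
    (hB : Integrable (fun x => ‖x‖ ^ 2) B) {t : ℝ} (ht : t < 1) :
    velocitySqGap A B t = t / (1 - t) * ((1 - t)⁻¹ ^ 2 *
      ∫ p, ‖postMean A (t / (1 - t)) ((t / (1 - t)) • p.1 + p.2) -
        postMean B (t / (1 - t)) ((t / (1 - t)) • p.1 + p.2)‖ ^ 2
        ∂(A.prod (stdGaussian (EuclideanSpace ℝ (Fin d))))) := by
  have := measurable_velocity hA ht
  have := measurable_velocity hB ht
  rw [velocitySqGap, integral_probPath ht (by fun_prop)]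
  simp_rw [velocity_sub_velocity hA hB ht, norm_smul, mul_pow, Real.norm_eq_abs, sq_abs,
    integral_const_mul]

theorem velocitySqGap_nonneg (A B : Measure (EuclideanSpace ℝ (Fin d))) {t : ℝ} (h0 : 0 ≤ t)
    (ht : t < 1) : 0 ≤ velocitySqGap A B t :=
  mul_nonneg (div_nonneg h0 (by linarith)) (integral_nonneg fun x => sq_nonneg _)

/-- Chain rule: da/dt = (1 - t)⁻² is exactly the factor between squared differences of velocities
and of posterior means. -/
theorem hasDerivAt_smoothedKL_time (hA : Integrable (fun x => ‖x‖ ^ 2) A)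
    (hB : Integrable (fun x => ‖x‖ ^ 2) B) {t : ℝ} (h0 : 0 < t) (ht : t < 1) :
    HasDerivAt (fun t => smoothedKL A B (t / (1 - t))) (velocitySqGap A B t) t := by
  have hs : 0 < 1 - t := by linarith
  have h1 : HasDerivAt (fun t : ℝ => t / (1 - t)) ((1 - t)⁻¹ ^ 2) t := by
    refine ((hasDerivAt_id t).fun_div ((hasDerivAt_id t).const_sub 1) hs.ne').congr_deriv ?_
    simp only [id]
    field_simp
    ring
  refine ((hasDerivAt_smoothedKL hA hB (div_pos h0 hs)).comp t h1).congr_deriv ?_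
  rw [velocitySqGap_eq hA hB ht]
  ring

theorem lintegral_velocitySqGap_Ioo (hA : Integrable (fun x => ‖x‖ ^ 2) A)
    (hB : Integrable (fun x => ‖x‖ ^ 2) B) {b : ℝ} (h0 : 0 ≤ b) (hb : b < 1) :
    ∫⁻ t in Set.Ioo 0 b, ENNReal.ofReal (velocitySqGap A B t) =
      ENNReal.ofReal (smoothedKL A B (b / (1 - b))) := by
  have hcont : ContinuousOn (fun t => smoothedKL A B (t / (1 - t))) (Set.Icc 0 b) := by
    intro t ht
    have hs : 1 - t ≠ 0 := by linarith [ht.2]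
    refine ContinuousAt.continuousWithinAt ?_
    exact ContinuousAt.comp (f := fun t : ℝ => t / (1 - t)) (continuousAt_smoothedKL hA hB _)
      (continuousAt_id.div (continuousAt_const.sub continuousAt_id) hs)
  have hderiv : ∀ t ∈ Set.Ioo 0 b, HasDerivAt (fun t => smoothedKL A B (t / (1 - t)))
      (velocitySqGap A B t) t := fun t ht =>
    hasDerivAt_smoothedKL_time hA hB ht.1 (ht.2.trans hb)
  -- A nonnegative derivative of a continuous function is automatically integrable.
  have hint : IntegrableOn (velocitySqGap A B) (Set.Ioc 0 b) :=
    intervalIntegral.integrableOn_deriv_of_nonneg hcont hderiv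
      fun t ht => velocitySqGap_nonneg A B ht.1.le (ht.2.trans hb)
  have hftc := intervalIntegral.integral_eq_sub_of_hasDerivAt_of_le h0 hcont hderiv
    ((intervalIntegrable_iff_integrableOn_Ioc_of_le h0).2 hint)
  rw [zero_div, smoothedKL_zero, sub_zero, intervalIntegral.integral_of_le h0,
    integral_Ioc_eq_integral_Ioo] at hftc
  rw [← hftc, ofReal_integral_eq_lintegral_ofReal (hint.mono_set Set.Ioo_subset_Ioc_self)]
  filter_upwards [ae_restrict_mem measurableSet_Ioo] with t ht
  exact velocitySqGap_nonneg A B ht.1.le (ht.2.trans hb)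

/-- The Kullback–Leibler divergence of the target laws as an integral along the probability
paths. -/
theorem klDiv_eq_lintegral_velocitySqGap (hA : Integrable (fun x => ‖x‖ ^ 2) A)
    (hB : Integrable (fun x => ‖x‖ ^ 2) B) :
    klDiv A B = ∫⁻ t in Set.Ioo 0 1, ENNReal.ofReal (velocitySqGap A B t) := by
  refine le_antisymm ?_ ?_
  · by_cases htop : ∫⁻ t in Set.Ioo 0 1, ENNReal.ofReal (velocitySqGap A B t) = ⊤
    · rw [htop]; exact le_top
    rw [← ENNReal.ofReal_toReal htop]
    refine klDiv_le_of_smoothedKL_le hA fun a ha => ?_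
    rw [← ENNReal.ofReal_le_iff_le_toReal htop]
    -- The time a/(1+a) is the one at which the strength equals `a`.
    have h1 : a / (1 + a) < 1 := by rw [div_lt_one (by linarith)]; linarith
    have h2 : a / (1 + a) / (1 - a / (1 + a)) = a := by field_simp; ring
    rw [← h2, ← lintegral_velocitySqGap_Ioo hA hB (by positivity) h1]
    exact lintegral_mono_set (Set.Ioo_subset_Ioo_right h1.le)
  · have hU : Set.Ioo (0 : ℝ) 1 = ⋃ n : ℕ, Set.Ioo (0 : ℝ) (1 - ((n : ℝ) + 1)⁻¹) := by
      ext t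
      simp only [Set.mem_Ioo, Set.mem_iUnion]
      constructor
      · rintro ⟨h0, h1⟩
        obtain ⟨n, hn⟩ := exists_nat_one_div_lt (sub_pos.2 h1)
        refine ⟨n, h0, ?_⟩
        rw [one_div] at hn
        linarith
      · rintro ⟨n, h0, h1⟩
        have : (0 : ℝ) < ((n : ℝ) + 1)⁻¹ := by positivity
        exact ⟨h0, by linarith⟩
    have hdir : Directed (· ⊆ ·) fun n : ℕ => Set.Ioo (0 : ℝ) (1 - ((n : ℝ) + 1)⁻¹) := by
      refine Monotone.directed_le fun m n hmn => Set.Ioo_subset_Ioo_right ?_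
      have : (m : ℝ) ≤ n := by exact_mod_cast hmn
      gcongr
    rw [hU, setLIntegral_iUnion_of_directed _ hdir]
    refine iSup_le fun n => ?_
    have h1 : ((n : ℝ) + 1)⁻¹ ≤ 1 :=
      inv_le_one_of_one_le₀ (by linarith [(Nat.cast_nonneg n : (0 : ℝ) ≤ n)])
    have h2 : (0 : ℝ) < ((n : ℝ) + 1)⁻¹ := by positivity
    rw [lintegral_velocitySqGap_Ioo hA hB (by linarith) (by linarith)]
    exact ofReal_smoothedKL_le_klDiv hA _

/-- The integrand of the difference between `velocityGap A B t` and `velocitySqGap A B t`. -/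
def crossTerm (B : Measure (EuclideanSpace ℝ (Fin d))) (t : ℝ)
    (p : EuclideanSpace ℝ (Fin d) × EuclideanSpace ℝ (Fin d)) : ℝ :=
  t / (1 - t) * ((1 - t)⁻¹ ^ 2 *
    inner ℝ (p.1 - postMean B (t / (1 - t)) ((t / (1 - t)) • p.1 + p.2))
      (postMean B (t / (1 - t)) ((t / (1 - t)) • p.1 + p.2) -
        (1 - t) • ((t / (1 - t)) • p.1 + p.2)))

theorem measurable_crossTerm (B : Measure (EuclideanSpace ℝ (Fin d))) [IsProbabilityMeasure B] :
    Measurable fun q : ℝ × (EuclideanSpace ℝ (Fin d) × EuclideanSpace ℝ (Fin d)) =>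
      crossTerm B q.1 q.2 := by
  unfold crossTerm; fun_prop

theorem integrable_inner_of_norm_sq_le (hA : Integrable (fun x => ‖x‖ ^ 2) A)
    {f g : EuclideanSpace ℝ (Fin d) × EuclideanSpace ℝ (Fin d) → EuclideanSpace ℝ (Fin d)}
    (hf : Measurable f) (hg : Measurable g) {c c' : ℝ}
    (hfb : ∀ p, ‖f p‖ ^ 2 ≤ c * (1 + (‖p.1‖ ^ 2 + ‖p.2‖ ^ 2)))
    (hgb : ∀ p, ‖g p‖ ^ 2 ≤ c' * (1 + (‖p.1‖ ^ 2 + ‖p.2‖ ^ 2))) :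
    Integrable (fun p => inner ℝ (f p) (g p))
      (A.prod (stdGaussian (EuclideanSpace ℝ (Fin d)))) := by
  refine integrable_prod_of_le_sq hA (by fun_prop) (C := c + c') fun p => ?_
  refine (abs_real_inner_le_norm _ _).trans ?_
  nlinarith [hfb p, hgb p, sq_nonneg (‖f p‖ - ‖g p‖), sq_nonneg ‖f p‖, sq_nonneg ‖g p‖]

theorem norm_sub_sq_le {x y : EuclideanSpace ℝ (Fin d)} {c c' m : ℝ} (hx : ‖x‖ ^ 2 ≤ c * m)
    (hy : ‖y‖ ^ 2 ≤ c' * m) : ‖x - y‖ ^ 2 ≤ (2 * (c + c')) * m := by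
  have h : ‖x - y‖ ^ 2 ≤ (‖x‖ + ‖y‖) ^ 2 := by gcongr; exact norm_sub_le _ _
  nlinarith [sq_nonneg (‖x‖ - ‖y‖)]

theorem exists_norm_postMean_sub_sq_le (hB : Integrable (fun x => ‖x‖ ^ 2) B) {a : ℝ} (ha : 0 < a)
    (s : ℝ) :
    ∃ C, ∀ p : EuclideanSpace ℝ (Fin d) × EuclideanSpace ℝ (Fin d),
      ‖postMean B a (a • p.1 + p.2) - s • (a • p.1 + p.2)‖ ^ 2 ≤
        C * (1 + (‖p.1‖ ^ 2 + ‖p.2‖ ^ 2)) := by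
  obtain ⟨C, -, hC⟩ := exists_norm_postMean_sq_le hB ha
  refine ⟨_, fun p => norm_sub_sq_le (hC p.1 p.2) (c' := s ^ 2 * (2 + 2 * a ^ 2)) ?_⟩
  rw [norm_smul, mul_pow, Real.norm_eq_abs, sq_abs, mul_assoc]
  have := one_add_norm_path_sq_le (abs_of_pos ha).le p.1 p.2
  gcongr
  linarith

theorem integrable_crossTerm (hA : Integrable (fun x => ‖x‖ ^ 2) A)
    (hB : Integrable (fun x => ‖x‖ ^ 2) B) {t : ℝ} (h0 : 0 < t) (ht : t < 1) :
    Integrable (crossTerm B t) (A.prod (stdGaussian (EuclideanSpace ℝ (Fin d)))) := by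
  have ha : 0 < t / (1 - t) := div_pos h0 (by linarith)
  obtain ⟨C, -, hC⟩ := exists_norm_postMean_sq_le hB ha
  obtain ⟨C', hC'⟩ := exists_norm_postMean_sub_sq_le hB ha (1 - t)
  refine ((integrable_inner_of_norm_sq_le hA (by fun_prop) (by fun_prop)
    (fun p => norm_sub_sq_le (c := 1) ?_ (hC p.1 p.2)) hC').const_mul _).const_mul _
  nlinarith [sq_nonneg ‖p.2‖]

/-- By the tower property, the posterior mean may replace the signal. -/
theorem integral_inner_sub_postMean (hA : Integrable (fun x => ‖x‖ ^ 2) A)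
    (hB : Integrable (fun x => ‖x‖ ^ 2) B) {a : ℝ} (ha : 0 < a) (s : ℝ) :
    ∫ p, inner ℝ (p.1 - postMean B a (a • p.1 + p.2))
        (postMean B a (a • p.1 + p.2) - s • (a • p.1 + p.2))
        ∂(A.prod (stdGaussian (EuclideanSpace ℝ (Fin d)))) =
      ∫ p, inner ℝ (postMean A a (a • p.1 + p.2) - postMean B a (a • p.1 + p.2))
        (postMean B a (a • p.1 + p.2) - s • (a • p.1 + p.2))
        ∂(A.prod (stdGaussian (EuclideanSpace ℝ (Fin d)))) := by
  obtain ⟨CA, -, hCA⟩ := exists_norm_postMean_sq_le hA ha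
  obtain ⟨CB, -, hCB⟩ := exists_norm_postMean_sq_le hB ha
  obtain ⟨C', hC'⟩ := exists_norm_postMean_sub_sq_le hB ha s
  have hi1 := integrable_inner_of_norm_sq_le hA (f := Prod.fst) (c := 1) measurable_fst
    (by fun_prop) (fun p => by nlinarith [sq_nonneg ‖p.2‖]) hC'
  have hi2 := integrable_inner_of_norm_sq_le hA
    (f := fun p => postMean A a (a • p.1 + p.2)) (by fun_prop) (by fun_prop)
    (fun p => hCA p.1 p.2) hC'
  have hi3 := integrable_inner_of_norm_sq_le hA
    (f := fun p => postMean B a (a • p.1 + p.2)) (by fun_prop) (by fun_prop)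
    (fun p => hCB p.1 p.2) hC'
  simp_rw [inner_sub_left]
  rw [integral_sub hi1 hi3, integral_sub hi2 hi3,
    integral_inner_eq_integral_inner_postMean hA a (φ := fun z => postMean B a z - s • z)
      (by fun_prop) hi1 hi2]

/-- When the signal has law `B`, its error x - m_B is orthogonal to every square-integrable function
of the observation. -/
theorem integral_crossTerm_self (hB : Integrable (fun x => ‖x‖ ^ 2) B) {t : ℝ} (h0 : 0 < t)
    (ht : t < 1) :
    ∫ p, crossTerm B t p ∂(B.prod (stdGaussian (EuclideanSpace ℝ (Fin d)))) = 0 := by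
  unfold crossTerm
  rw [integral_const_mul, integral_const_mul,
    integral_inner_sub_postMean hB hB (div_pos h0 (by linarith))]
  simp

/-- Write u^A = (u^A - u^B) + u^B in the first factor. The remaining term is linear in m_A, so the
tower property puts x in place of m_A. The resulting integrand no longer involves `A`, which allows
averaging over target laws. -/
theorem velocityGap_eq_add_integral_crossTerm (hA : Integrable (fun x => ‖x‖ ^ 2) A)
    (hB : Integrable (fun x => ‖x‖ ^ 2) B) {t : ℝ} (h0 : 0 < t) (ht : t < 1) :
    velocityGap A B t = velocitySqGap A B t +
      ∫ p, crossTerm B t p ∂(A.prod (stdGaussian (EuclideanSpace ℝ (Fin d)))) := by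
  have ha : 0 < t / (1 - t) := div_pos h0 (by linarith)
  have := measurable_velocity hA ht
  have := measurable_velocity hB ht
  obtain ⟨CA, -, hCA⟩ := exists_norm_postMean_sq_le hA ha
  obtain ⟨CB, -, hCB⟩ := exists_norm_postMean_sq_le hB ha
  obtain ⟨C', hC'⟩ := exists_norm_postMean_sub_sq_le hB ha (1 - t)
  have hi1 := integrable_inner_of_norm_sq_le hA (by fun_prop) (by fun_prop)
    (fun p => norm_sub_sq_le (hCA p.1 p.2) (hCB p.1 p.2))
    (fun p => norm_sub_sq_le (hCA p.1 p.2) (hCB p.1 p.2))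
  have hi2 := integrable_inner_of_norm_sq_le hA (by fun_prop) (by fun_prop)
    (fun p => norm_sub_sq_le (hCA p.1 p.2) (hCB p.1 p.2)) hC'
  rw [velocityGap, integral_probPath ht (by fun_prop), velocitySqGap_eq hA hB ht]
  unfold crossTerm
  simp_rw [← real_inner_self_eq_norm_sq]
  rw [integral_const_mul, integral_const_mul, integral_const_mul,
    integral_inner_sub_postMean hA hB ha, ← mul_add, ← mul_add, ← integral_add hi1 hi2]
  congr 1
  rw [← integral_const_mul]
  refine integral_congr_ae (ae_of_all _ fun p => ?_)
  simp only
  rw [velocity_sub_velocity hA hB ht, velocity_eq hA ht, real_inner_smul_left,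
    real_inner_smul_right, ← inner_add_right, real_inner_comm, ← mul_assoc, sq]
  congr 2
  abel

end Velocity

/-! ### Averaging over the guidance signal -/

section Conditional

variable {𝒴 : Type*} [MeasurableSpace 𝒴]

theorem klDiv_map_swap {S T : Type*} [MeasurableSpace S] [MeasurableSpace T]
    (μ ν : Measure (S × T)) [IsFiniteMeasure μ] [IsFiniteMeasure ν] :
    klDiv (μ.map Prod.swap) (ν.map Prod.swap) = klDiv μ ν := by
  refine le_antisymm (klDiv_map_le _ _ measurable_swap) ?_
  have h := klDiv_map_le (μ.map Prod.swap) (ν.map Prod.swap) (measurable_swap (α := T) (β := S))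
  rwa [Measure.map_map measurable_swap measurable_swap, Prod.swap_swap_eq, Measure.map_id,
    Measure.map_map measurable_swap measurable_swap, Prod.swap_swap_eq, Measure.map_id] at h

/-- The divergence of a composition-product from the product measure is the average of the
conditional divergences. -/
theorem klDiv_compProd_prod {S : Type*} [MeasurableSpace S] [MeasurableSpace.CountablyGenerated S]
    {μ : Measure 𝒴} [IsProbabilityMeasure μ] {κ : Kernel 𝒴 S} [IsMarkovKernel κ]
    {B : Measure S} [IsProbabilityMeasure B] (hac : ∀ᵐ y ∂μ, κ y ≪ B) :
    klDiv (μ ⊗ₘ κ) (μ.prod B) = ∫⁻ y, klDiv (κ y) B ∂μ := by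
  -- The kernel derivative is a jointly measurable choice of the conditional densities.
  set r : 𝒴 × S → ℝ≥0∞ := fun p => Kernel.rnDeriv κ (Kernel.const 𝒴 B) p.1 p.2 with hr
  have hrm : Measurable r := Kernel.measurable_rnDeriv _ _
  have hry : ∀ y, (fun x => r (y, x)) =ᵐ[B] (κ y).rnDeriv B := fun y => by
    have := Kernel.rnDeriv_eq_rnDeriv_measure (κ := κ) (η := Kernel.const 𝒴 B) (a := y)
    rwa [Kernel.const_apply] at this
  have hwd : μ ⊗ₘ κ = (μ.prod B).withDensity r := by
    refine Measure.ext_of_lintegral _ fun f hf => ?_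
    rw [Measure.lintegral_compProd hf, lintegral_withDensity_eq_lintegral_mul _ hrm hf,
      lintegral_prod _ (by fun_prop)]
    refine lintegral_congr_ae ?_
    filter_upwards [hac] with y hy
    have hfy : Measurable fun x => f (y, x) := by fun_prop
    rw [← lintegral_rnDeriv_mul hy hfy.aemeasurable]
    refine lintegral_congr_ae ?_
    filter_upwards [hry y] with x hx
    rw [Pi.mul_apply, ← hx]
  have hac' : μ ⊗ₘ κ ≪ μ.prod B := by
    rw [hwd]; exact withDensity_absolutelyContinuous _ _
  rw [klDiv_eq_lintegral_klFun_of_ac hac']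
  have h1 : (μ ⊗ₘ κ).rnDeriv (μ.prod B) =ᵐ[μ.prod B] r := by
    rw [hwd]; exact Measure.rnDeriv_withDensity _ hrm
  calc ∫⁻ p, ENNReal.ofReal (klFun ((μ ⊗ₘ κ).rnDeriv (μ.prod B) p).toReal) ∂(μ.prod B)
      = ∫⁻ p, ENNReal.ofReal (klFun (r p).toReal) ∂(μ.prod B) := by
        refine lintegral_congr_ae ?_
        filter_upwards [h1] with p hp
        rw [hp]
    _ = ∫⁻ y, ∫⁻ x, ENNReal.ofReal (klFun (r (y, x)).toReal) ∂B ∂μ :=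
        lintegral_prod _ (by fun_prop)
    _ = _ := by
        refine lintegral_congr_ae ?_
        filter_upwards [hac] with y hy
        rw [klDiv_eq_lintegral_klFun_of_ac hy]
        refine lintegral_congr_ae ?_
        filter_upwards [hry y] with x hx
        rw [hx]

variable {d : ℕ}

/-- Chain rule for Radon–Nikodym derivatives: the density of `B` is positive and finite `A`-almost
everywhere, so the quotient of densities is dA/dB there. -/
theorem integral_density_mul_log_eq_toReal_klDiv {A B : Measure (EuclideanSpace ℝ (Fin d))}
    [IsProbabilityMeasure A] [IsProbabilityMeasure B] (hA : A ≪ volume) (hB : B ≪ volume)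
    (hAB : A ≪ B) :
    ∫ x, density A x * Real.log (density A x / density B x) = (klDiv A B).toReal := by
  rw [toReal_klDiv_of_measure_eq hAB (by simp)]
  simp only [density]
  rw [integral_toReal_rnDeriv_mul hA]
  refine integral_congr_ae ?_
  filter_upwards [hA.ae_le (Measure.rnDeriv_mul_rnDeriv (κ := volume) hAB),
    hAB.ae_le (Measure.rnDeriv_pos hB), hA.ae_le (B.rnDeriv_ne_top volume)] with x hx hpos hne
  rw [llr, ← hx, Pi.mul_apply, ENNReal.toReal_mul, mul_div_cancel_right₀]
  exact (ENNReal.toReal_pos hpos.ne' hne).ne'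

theorem stronglyMeasurable_integral_crossTerm (κ : Kernel 𝒴 (EuclideanSpace ℝ (Fin d)))
    [IsMarkovKernel κ] (B : Measure (EuclideanSpace ℝ (Fin d))) [IsProbabilityMeasure B] :
    StronglyMeasurable fun z : 𝒴 × ℝ => ∫ p, crossTerm B z.2 p
      ∂((κ z.1).prod (stdGaussian (EuclideanSpace ℝ (Fin d)))) := by
  set η : Kernel (𝒴 × ℝ) (EuclideanSpace ℝ (Fin d) × EuclideanSpace ℝ (Fin d)) :=
    (κ.comap Prod.fst measurable_fst) ×ₖ
      (Kernel.const (𝒴 × ℝ) (stdGaussian (EuclideanSpace ℝ (Fin d)))) with hη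
  have hm : StronglyMeasurable fun q : (𝒴 × ℝ) ×
      (EuclideanSpace ℝ (Fin d) × EuclideanSpace ℝ (Fin d)) => crossTerm B q.1.2 q.2 :=
    ((measurable_crossTerm B).comp
      ((measurable_snd.comp measurable_fst).prodMk measurable_snd)).stronglyMeasurable
  have h := hm.integral_kernel_prod_right' (κ := η)
  simpa [hη, Kernel.prod_apply, Kernel.comap_apply] using h

/-- The mixture of the laws `κ y` is `B` and the integrand depends on `B` alone, so the average
reduces to `integral_crossTerm_self`. -/
theorem integral_integral_crossTerm {μ : Measure 𝒴} [IsProbabilityMeasure μ]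
    {κ : Kernel 𝒴 (EuclideanSpace ℝ (Fin d))} [IsMarkovKernel κ]
    {B : Measure (EuclideanSpace ℝ (Fin d))} [IsProbabilityMeasure B] (hκ : κ ∘ₘ μ = B)
    (hB : Integrable (fun x => ‖x‖ ^ 2) B) {t : ℝ} (h0 : 0 < t) (ht : t < 1) :
    Integrable (fun y => ∫ p, crossTerm B t p
      ∂((κ y).prod (stdGaussian (EuclideanSpace ℝ (Fin d))))) μ ∧
    ∫ y, ∫ p, crossTerm B t p ∂((κ y).prod (stdGaussian (EuclideanSpace ℝ (Fin d)))) ∂μ = 0 := by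
  have hκ2 : ∀ᵐ y ∂μ, Integrable (fun x => ‖x‖ ^ 2) (κ y) :=
    Measure.ae_integrable_of_integrable_comp (hκ ▸ hB)
  have hμ : B = (κ ∘ₖ Kernel.const Unit μ) () := by rw [← Measure.comp_eq_comp_const_apply, hκ]
  have hF : Integrable (fun x => ∫ n, crossTerm B t (x, n)
      ∂(stdGaussian (EuclideanSpace ℝ (Fin d)))) ((κ ∘ₖ Kernel.const Unit μ) ()) := by
    rw [← hμ]
    exact (integrable_crossTerm hB hB h0 ht).integral_prod_left
  have heq : (fun y => ∫ x, ∫ n, crossTerm B t (x, n) ∂(stdGaussian (EuclideanSpace ℝ (Fin d)))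
      ∂(κ y)) =ᵐ[μ] fun y => ∫ p, crossTerm B t p
      ∂((κ y).prod (stdGaussian (EuclideanSpace ℝ (Fin d)))) := by
    filter_upwards [hκ2] with y hy
    rw [integral_prod _ (integrable_crossTerm hy hB h0 ht)]
  refine ⟨Integrable.congr hF.integral_comp heq, ?_⟩
  have h1 := Kernel.integral_comp hF
  rw [← hμ, ← integral_prod _ (integrable_crossTerm hB hB h0 ht),
    integral_crossTerm_self hB h0 ht, Kernel.const_apply, integral_congr_ae heq] at h1
  exact h1.symm

/-- The averaged divergence of the conditional laws from the marginal law, as the averaged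
velocity gap. -/
theorem lintegral_klDiv_eq_integral_velocityGap {μ : Measure 𝒴} [IsProbabilityMeasure μ]
    {κ : Kernel 𝒴 (EuclideanSpace ℝ (Fin d))} [IsMarkovKernel κ]
    {B : Measure (EuclideanSpace ℝ (Fin d))} [IsProbabilityMeasure B] (hκ : κ ∘ₘ μ = B)
    (hB : Integrable (fun x => ‖x‖ ^ 2) B)
    (hint : Integrable (fun z : 𝒴 × ℝ => velocityGap (κ z.1) B z.2)
      (μ.prod (volume.restrict (Set.Ioo (0 : ℝ) 1)))) :
    AEMeasurable (fun y => klDiv (κ y) B) μ ∧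
    ∫⁻ y, klDiv (κ y) B ∂μ =
      ENNReal.ofReal (∫ y, (∫ t in Set.Ioo (0 : ℝ) 1, velocityGap (κ y) B t) ∂μ) ∧
    0 ≤ ∫ y, (∫ t in Set.Ioo (0 : ℝ) 1, velocityGap (κ y) B t) ∂μ := by
  have hκ2 : ∀ᵐ y ∂μ, Integrable (fun x => ‖x‖ ^ 2) (κ y) :=
    Measure.ae_integrable_of_integrable_comp (hκ ▸ hB)
  set w : 𝒴 → ℝ → ℝ := fun y t => ∫ p, crossTerm B t p
      ∂((κ y).prod (stdGaussian (EuclideanSpace ℝ (Fin d)))) with hw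
  have hwm : StronglyMeasurable fun z : 𝒴 × ℝ => w z.1 z.2 :=
    stronglyMeasurable_integral_crossTerm κ B
  have hsq : ∀ᵐ y ∂μ, ∀ t ∈ Set.Ioo (0 : ℝ) 1,
      velocityGap (κ y) B t - w y t = velocitySqGap (κ y) B t := by
    filter_upwards [hκ2] with y hy t ht
    rw [velocityGap_eq_add_integral_crossTerm hy hB ht.1 ht.2, hw]
    ring
  have hm : AEMeasurable (fun z : 𝒴 × ℝ => ENNReal.ofReal (velocityGap (κ z.1) B z.2 - w z.1 z.2))
      (μ.prod (volume.restrict (Set.Ioo (0 : ℝ) 1))) :=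
    (hint.1.aemeasurable.sub hwm.measurable.aemeasurable).ennreal_ofReal
  have hkl : (fun y => klDiv (κ y) B) =ᵐ[μ] fun y => ∫⁻ t in Set.Ioo (0 : ℝ) 1,
      ENNReal.ofReal (velocityGap (κ y) B t - w y t) := by
    filter_upwards [hκ2, hsq] with y hy hy'
    rw [klDiv_eq_lintegral_velocitySqGap hy hB]
    exact setLIntegral_congr_fun measurableSet_Ioo fun t ht => by rw [hy' t ht]
  -- The cross term is integrable in y for each fixed t, but joint integrability is not available.
  -- Tonelli's theorem is therefore applied to the nonnegative difference, and the y-integral, taken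
  -- first, removes the cross term.
  have ht : ∀ᵐ t ∂(volume.restrict (Set.Ioo (0 : ℝ) 1)),
      0 ≤ ∫ y, velocityGap (κ y) B t ∂μ ∧
      ∫⁻ y, ENNReal.ofReal (velocityGap (κ y) B t - w y t) ∂μ =
        ENNReal.ofReal (∫ y, velocityGap (κ y) B t ∂μ) := by
    filter_upwards [hint.prod_left_ae, ae_restrict_mem measurableSet_Ioo] with t hgt ht
    obtain ⟨hwi, hw0⟩ := integral_integral_crossTerm hκ hB ht.1 ht.2
    have hnn : 0 ≤ᵐ[μ] fun y => velocityGap (κ y) B t - w y t := by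
      filter_upwards [hsq] with y hy
      rw [Pi.zero_apply, hy t ht]
      exact velocitySqGap_nonneg _ _ ht.1.le ht.2
    have hI : ∫ y, (velocityGap (κ y) B t - w y t) ∂μ = ∫ y, velocityGap (κ y) B t ∂μ := by
      rw [integral_sub hgt hwi, hw0, sub_zero]
    rw [← hI]
    exact ⟨integral_nonneg_of_ae hnn,
      (ofReal_integral_eq_lintegral_ofReal (hgt.sub hwi) hnn).symm⟩
  have hswap : ∫ y, (∫ t in Set.Ioo (0 : ℝ) 1, velocityGap (κ y) B t) ∂μ =
      ∫ t in Set.Ioo (0 : ℝ) 1, ∫ y, velocityGap (κ y) B t ∂μ :=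
    integral_integral_swap (f := fun y t => velocityGap (κ y) B t) hint
  refine ⟨hm.lintegral_prod_right'.congr hkl.symm, ?_, ?_⟩
  · rw [lintegral_congr_ae hkl, lintegral_lintegral_swap hm, hswap,
      ofReal_integral_eq_lintegral_ofReal hint.integral_prod_right
        (ht.mono fun t h => h.1)]
    exact lintegral_congr_ae (ht.mono fun t h => h.2)
  · rw [hswap]
    exact integral_nonneg_of_ae (ht.mono fun t h => h.1)

end Conditional

end

end FlowMI

/-! ### The mutual information formula -/

theorem mainTheorem1 {Ω : Type*} [MeasurableSpace Ω] (P : Measure Ω) [IsProbabilityMeasure P]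
    {𝒴 : Type*} [MeasurableSpace 𝒴] {d : ℕ}
    (X : Ω → EuclideanSpace ℝ (Fin d)) (Y : Ω → 𝒴)
    (hX : Measurable X) (hY : Measurable Y)
    (hXpdf : ∀ᵐ y ∂(P.map Y), condDistrib X Y P y ≪ volume)
    (hX2 : MemLp X 2 P)
    (hint : Integrable
      (fun z : 𝒴 × ℝ => FlowMI.velocityGap (condDistrib X Y P z.1) (P.map X) z.2)
      ((P.map Y).prod (volume.restrict (Set.Ioo (0 : ℝ) 1)))) :
    FlowMI.mutualInfo P X Y ≠ ⊤ ∧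
    FlowMI.mutualInfo P X Y = ∫⁻ y, klDiv (condDistrib X Y P y) (P.map X) ∂(P.map Y) ∧
    (FlowMI.mutualInfo P X Y).toReal =
      ∫ y, (∫ x, FlowMI.density (condDistrib X Y P y) x *
        Real.log (FlowMI.density (condDistrib X Y P y) x / FlowMI.density (P.map X) x))
        ∂(P.map Y) ∧
    (FlowMI.mutualInfo P X Y).toReal =
      ∫ y, (∫ t in (0 : ℝ)..1, FlowMI.velocityGap (condDistrib X Y P y) (P.map X) t)
        ∂(P.map Y) := by
  have : IsProbabilityMeasure (P.map X) := Measure.isProbabilityMeasure_map hX.aemeasurable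
  have : IsProbabilityMeasure (P.map Y) := Measure.isProbabilityMeasure_map hY.aemeasurable
  have hκ := condDistrib_comp_map (μ := P) hY.aemeasurable hX.aemeasurable
  have hB : Integrable (fun x => ‖x‖ ^ 2) (P.map X) :=
    (integrable_map_measure (Continuous.aestronglyMeasurable (by fun_prop)) hX.aemeasurable).2
      (hX2.integrable_norm_pow (by norm_num))
  obtain ⟨hmeas, heq, hnn⟩ := FlowMI.lintegral_klDiv_eq_integral_velocityGap hκ hB hint
  have hfin : ∫⁻ y, klDiv (condDistrib X Y P y) (P.map X) ∂(P.map Y) ≠ ⊤ := by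
    rw [heq]; exact ENNReal.ofReal_ne_top
  have hlt := ae_lt_top' hmeas hfin
  -- Finiteness of the averaged divergence makes almost every conditional divergence finite, which
  -- forces absolute continuity.
  have hac : ∀ᵐ y ∂(P.map Y), condDistrib X Y P y ≪ P.map X := by
    filter_upwards [hlt] with y hy
    exact (klDiv_ne_top_iff.1 hy.ne).1
  have hBvol : P.map X ≪ volume := by
    refine Measure.AbsolutelyContinuous.mk fun s hs h0 => ?_
    rw [← hκ, Measure.bind_apply hs (Kernel.aemeasurable _), lintegral_eq_zero_iff
      (Kernel.measurable_coe _ hs)]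
    filter_upwards [hXpdf] with y hy
    exact hy h0
  -- The composition-product lists Y first, whence the swap of coordinates.
  have hMI : FlowMI.mutualInfo P X Y =
      ∫⁻ y, klDiv (condDistrib X Y P y) (P.map X) ∂(P.map Y) := by
    rw [← FlowMI.klDiv_compProd_prod hac, compProd_map_condDistrib hX.aemeasurable,
      FlowMI.mutualInfo, ← FlowMI.klDiv_map_swap, Measure.prod_swap,
      Measure.map_map measurable_swap (hX.prodMk hY)]
    rfl
  refine ⟨hMI ▸ hfin, hMI, ?_, ?_⟩
  · rw [hMI, ← integral_toReal hmeas hlt]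
    refine integral_congr_ae ?_
    filter_upwards [hXpdf, hac] with y hy hy'
    rw [FlowMI.integral_density_mul_log_eq_toReal_klDiv hy hBvol hy']
  · rw [hMI, heq, ENNReal.toReal_ofReal hnn]
    simp_rw [intervalIntegral.integral_of_le zero_le_one, integral_Ioc_eq_integral_Ioo]
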